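/- Let $m\ge 1$ and let $(S,\mathscr D=\ker\theta,J)$ be a regular Sasaki manifold of dimension $2m+1$: $\theta$ is a contact form, $J$ is an integrable complex structure on $\mathscr D$ with symmetric positive definite Levi form $h^\theta=d\theta(\cdot,J\cdot)$, and the Reeb field $Z$ of $\theta$ (defined by $\theta(Z)=1$, $d\theta(Z,\cdot)=0$) preserves $J$ and generates a one-parameter group $A'\cong\mathbb R$ or $S^1$ acting freely and properly on $S$. Let $(N=S/A',J^N,g^N)$ be the associated $m$-dimensional Kähler manifold, with projection $\pi^S\colon S\to N$: $\pi^S_*$ maps $J$ to $J^N$, and $(\pi^S)^*g^N=h^\theta$ on $\mathscr D$. Let $M=\mathbb R\times S$ be the trivial $\mathbb R$-bundle, with projection $\pi\colon M\to S$ and fundamental vector field $p=\partial/\partial t$, and let $g$ be a Lorentzian metric of Kähler–Sasaki type on $M$, that is, a Lorentzian metric of signature $(-,+,\dots,+)$ such that the orthogonal complement of $p$ is the distribution $\mathscr W=\pi_*^{-1}(\mathscr D)=\ker\pi^*\theta$ and $g|_{\mathscr W}=\sigma\,(\pi^*h^\theta)|_{\mathscr W}$ for a smooth function $\sigma>0$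 on $M$. Suppose that $N$ admits a global nowhere vanishing holomorphic $(m,0)$-form (a holomorphic volume form). Then there exists on $M$ a nowhere vanishing, globally defined generalised electromagnetic plane wave $F$. Here, on a Lorentzian manifold $(M,g)$ of dimension $2k$ (in our case $k=m+1$), a generalised electromagnetic plane wave is a smooth real $k$-form $F$ on $M$ that is harmonic, i.e. $dF=0$ and $d(\ast F)=0$ for the Hodge operator $\ast$ of a canonical volume form of $(M,g)$ (in particular $M$ is orientable), and of the form $F=q\wedge\alpha$ for a smooth $1$-form $q=g(\ell,\cdot)$, $\ell$ a nowhere zero null vector field, and a smooth $(k-1)$-form $\alpha$, such that every null vector in $\ker q$ also lies in $\ker\alpha$. -/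

import Mathlib

open scoped Manifold ContDiff Topology

noncomputable section

/-! ### Exterior algebra of a real vector space -/

section LinearAlgebra

variable {V : Type*} [AddCommGroup V] [Module ℝ V] [TopologicalSpace V]

/-- The wedge product of real alternating forms (the sum over shuffles, with no extra factor). -/
def wedge {p q : ℕ} (a : V [⋀^Fin p]→L[ℝ] ℝ) (b : V [⋀^Fin q]→L[ℝ] ℝ) :
    V [⋀^Fin (p + q)]→L[ℝ] ℝ :=
  { ((LinearMap.mul' ℝ ℝ).compAlternatingMap
      (a.toAlternatingMap.domCoprod b.toAlternatingMap)).domDomCongr finSumFinEquiv with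
    cont := by
      change Continuous fun v : Fin (p + q) → V =>
        LinearMap.mul' ℝ ℝ ((a.toAlternatingMap.domCoprod b.toAlternatingMap)
          (fun i => v (finSumFinEquiv i)))
      simp only [AlternatingMap.domCoprod_apply, sum_apply, map_sum]
      refine continuous_finsetSum _ fun σ _ => ?_
      induction σ using Quotient.inductionOn' with
      | h σ =>
        have key : ∀ v : Fin (p + q) → V,
            LinearMap.mul' ℝ ℝ (AlternatingMap.domCoprod.summand a.toAlternatingMap
              b.toAlternatingMap (Quotient.mk'' σ) (fun i => v (finSumFinEquiv i))) =
            ((Equiv.Perm.sign σ : ℤ) : ℝ) *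
              (a (fun i => v (finSumFinEquiv (σ (Sum.inl i)))) *
                b (fun i => v (finSumFinEquiv (σ (Sum.inr i))))) := by
          intro v
          rw [AlternatingMap.domCoprod.summand_mk'', Units.smul_def,
            _root_.smul_apply, map_zsmul, zsmul_eq_mul]
          rfl
        simp only [key]
        have h1 : Continuous fun v : Fin (p + q) → V =>
            a (fun i => v (finSumFinEquiv (σ (Sum.inl i)))) :=
          a.cont.comp (continuous_pi fun i => continuous_apply _)
        have h2 : Continuous fun v : Fin (p + q) → V =>
            b (fun i => v (finSumFinEquiv (σ (Sum.inr i)))) :=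
          b.cont.comp (continuous_pi fun i => continuous_apply _)
        exact continuous_const.mul (h1.mul h2) }

/-- The kernel of an alternating form: `v` lies in it when the contraction of the form with `v`
(in any slot) vanishes. -/
def InFormKernel {p : ℕ} (a : V [⋀^Fin p]→L[ℝ] ℝ) (v : V) : Prop :=
  ∀ (w : Fin p → V) (i : Fin p), a (Function.update w i v) = 0

/-- The signs `(-1, 1, …, 1)` of the Lorentzian signature. -/
def lorentzSign {n : ℕ} (i : Fin n) : ℝ := if (i : ℕ) = 0 then -1 else 1

/-- The basis `e` is orthonormal for the scalar product `g` of signature `(-, +, …, +)`. -/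
def IsLorentzBasis {n : ℕ} (g : V →L[ℝ] V →L[ℝ] ℝ) (e : Module.Basis (Fin n) ℝ V) : Prop :=
  ∀ i j, g (e i) (e j) = if i = j then lorentzSign i else 0

/-- The scalar product `g(a, b)` of `p`-forms that is induced by a Lorentzian scalar product `g`
on `V`, computed in a `g`-orthonormal basis `e` (it does not depend on the choice of `e`). It is
normalised so that the forms `eⁱ¹ ∧ ⋯ ∧ eⁱᵖ` with `i₁ < ⋯ < iₚ` have square `±1`. -/
def formInner {n p : ℕ} (e : Module.Basis (Fin n) ℝ V) (a b : V [⋀^Fin p]→L[ℝ] ℝ) : ℝ :=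
  ((p.factorial : ℝ))⁻¹ *
    ∑ s : Fin p → Fin n, (∏ i, lorentzSign (s i)) * a (fun i => e (s i)) * b (fun i => e (s i))

/-- `c = ∗b`, the Hodge dual with respect to the Lorentzian scalar product `g` and the volume
form `vol`: `a ∧ c = g(a, b) vol` for every `p`-form `a`. -/
def IsHodgeDual {p q : ℕ} (g : V →L[ℝ] V →L[ℝ] ℝ) (vol : V [⋀^Fin (p + q)]→L[ℝ] ℝ)
    (b : V [⋀^Fin p]→L[ℝ] ℝ) (c : V [⋀^Fin q]→L[ℝ] ℝ) : Prop :=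
  ∀ e : Module.Basis (Fin (p + q)) ℝ V, IsLorentzBasis g e →
    ∀ a : V [⋀^Fin p]→L[ℝ] ℝ, wedge a c = formInner e a b • vol

/-- `q` is a null covector: `q = g(p, ·)` for a nonzero null vector `p`. -/
def IsNullCovector (g : V →L[ℝ] V →L[ℝ] ℝ) (q : V [⋀^Fin 1]→L[ℝ] ℝ) : Prop :=
  ∃ p : V, p ≠ 0 ∧ g p p = 0 ∧ ∀ v, q ![v] = g p v

end LinearAlgebra

/-! ### Differential forms on manifolds (without boundary) -/

section Forms

variable {𝕜 : Type*} [NontriviallyNormedField 𝕜]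
  {E : Type*} [NormedAddCommGroup E] [NormedSpace 𝕜 E] {H : Type*} [TopologicalSpace H]

/-- `F`-valued differential `p`-forms on `M`; for `𝕜 = ℂ` and a complex manifold `M` these are
the forms of type `(p, 0)`. -/
abbrev DiffForm (I : ModelWithCorners 𝕜 E H) (M : Type*) [TopologicalSpace M] [ChartedSpace H M]
    (F : Type*) [NormedAddCommGroup F] [NormedSpace 𝕜 F] (p : ℕ) :=
  ∀ x : M, TangentSpace I x [⋀^Fin p]→L[𝕜] F

variable {I : ModelWithCorners 𝕜 E H} {M : Type*} [TopologicalSpace M] [ChartedSpace H M]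
  {F : Type*} [NormedAddCommGroup F] [NormedSpace 𝕜 F] {p : ℕ}

/-- A form read in the preferred chart at `x₀`, i.e. pulled back by the inverse of the chart. -/
def formInChart (a : DiffForm I M F p) (x₀ : M) (y : E) : E [⋀^Fin p]→L[𝕜] F :=
  (a ((extChartAt I x₀).symm y)).compContinuousLinearMap
    (mfderiv 𝓘(𝕜, E) I (extChartAt I x₀).symm y)

/-- Smooth forms (for `𝕜 = ℂ`: holomorphic forms), i.e. smooth when read in charts. -/
def IsSmoothForm (a : DiffForm I M F p) : Prop :=
  ∀ x₀ : M, ContDiffOn 𝕜 ∞ (formInChart a x₀) (extChartAt I x₀).target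

/-- The exterior derivative, computed in charts. For `1`-forms the convention is
`da(X, Y) = X a(Y) - Y a(X) - a([X, Y])`. -/
def extD (a : DiffForm I M F p) : DiffForm I M F (p + 1) := fun x =>
  (extDeriv (formInChart a x) (extChartAt I x x)).compContinuousLinearMap
    (mfderiv I 𝓘(𝕜, E) (extChartAt I x) x)

end Forms

/-! ### Lorentzian manifolds and generalised plane waves -/

section Fields

variable {E : Type*} [NormedAddCommGroup E] [NormedSpace ℝ E] {H : Type*} [TopologicalSpace H]

/-- Fields of bilinear forms on the tangent spaces of `M`. -/
abbrev BilinField (I : ModelWithCorners ℝ E H) (M : Type*) [TopologicalSpace M]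
    [ChartedSpace H M] :=
  ∀ x : M, TangentSpace I x →L[ℝ] TangentSpace I x →L[ℝ] ℝ

variable {I : ModelWithCorners ℝ E H} {M : Type*} [TopologicalSpace M] [ChartedSpace H M]

/-- Smoothness of a field of bilinear forms on a finite-dimensional manifold: the components in
charts are smooth. -/
def IsSmoothBilin (g : BilinField I M) : Prop :=
  ∀ (x₀ : M) (u v : E), ContDiffOn ℝ ∞
    (fun y : E => g ((extChartAt I x₀).symm y)
      (mfderiv 𝓘(ℝ, E) I (extChartAt I x₀).symm y u)
      (mfderiv 𝓘(ℝ, E) I (extChartAt I x₀).symm y v))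
    (extChartAt I x₀).target

variable (I M) in
/-- A Lorentzian metric, of signature `(-, +, …, +)`, on a manifold of dimension `n`. -/
structure LorentzMetric (n : ℕ) where
  /-- the scalar products on the tangent spaces -/
  g : BilinField I M
  smooth : IsSmoothBilin g
  lorentz : ∀ x, ∃ e : Module.Basis (Fin n) ℝ (TangentSpace I x), IsLorentzBasis (g x) e

/-- `vol` is the canonical volume form of the Lorentzian manifold for one of its orientations: a
smooth `n`-form taking the values `±1` on orthonormal bases. -/
structure IsVolumeForm {n : ℕ} (g : LorentzMetric I M n) (vol : DiffForm I M ℝ n) : Prop where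
  smooth : IsSmoothForm vol
  unit : ∀ (x : M) (e : Module.Basis (Fin n) ℝ (TangentSpace I x)), IsLorentzBasis (g.g x) e →
    |vol x e| = 1

/-- Harmonic forms on a (necessarily orientable) Lorentzian manifold: `dF = 0` and `d(∗F) = 0`.
The canonical volume form is unique up to a locally constant sign, so that the second equation
does not depend on its choice. -/
structure IsHarmonic {p q : ℕ} (g : LorentzMetric I M (p + q)) (F : DiffForm I M ℝ p) :
    Prop where
  smooth : IsSmoothForm F
  closed : ∀ x, extD F x = 0
  coclosed : ∃ vol : DiffForm I M ℝ (p + q), IsVolumeForm g vol ∧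
    ∃ G : DiffForm I M ℝ q, IsSmoothForm G ∧ (∀ x, IsHodgeDual (g.g x) (vol x) (F x) (G x)) ∧
      ∀ x, extD G x = 0

/-- Generalised electromagnetic plane waves on a Lorentzian manifold of dimension `2k`, where
`k = 1 + m`: harmonic `k`-forms `F = q ∧ α` with `q` a null `1`-form and `α` a `(k-1)`-form such
that every null vector in `ker q` lies in `ker α`. -/
structure IsGeneralisedPlaneWave {m : ℕ} (g : LorentzMetric I M ((1 + m) + (1 + m)))
    (F : DiffForm I M ℝ (1 + m)) : Prop where
  harmonic : IsHarmonic g F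
  decomposable : ∃ (q : DiffForm I M ℝ 1) (α : DiffForm I M ℝ m),
    IsSmoothForm q ∧ IsSmoothForm α ∧
    (∀ x, IsNullCovector (g.g x) (q x)) ∧
    (∀ x, F x = wedge (q x) (α x)) ∧
    ∀ (x : M) (v : TangentSpace I x), q x ![v] = 0 → g.g x v v = 0 → InFormKernel (α x) v

/-! ### Regular Sasaki manifolds -/

/-- Smoothness of a vector field. -/
def IsSmoothField [IsManifold I ∞ M] (X : ∀ x : M, TangentSpace I x) : Prop :=
  ContMDiff I I.tangent ∞ fun x => (⟨x, X x⟩ : TangentBundle I M)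

variable (I M) in
/-- A Sasaki manifold `(S, 𝒟 = ker θ, J)`: a contact form `θ` and a strongly pseudoconvex
integrable CR structure `(𝒟, J)` with positive Levi form `dθ(·, J·)`, preserved by the Reeb
field `Z` of `θ`. The complex structure `J` of `𝒟` is extended to the tangent spaces by
`J Z = 0`. -/
structure SasakiManifold [IsManifold I ∞ M] where
  /-- the contact form -/
  θ : DiffForm I M ℝ 1
  /-- the Reeb vector field -/
  Z : ∀ x : M, TangentSpace I x
  /-- the complex structure of the contact distribution -/
  J : ∀ x : M, TangentSpace I x →L[ℝ] TangentSpace I x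
  smooth_θ : IsSmoothForm θ
  contact : ∀ (x : M) (u : TangentSpace I x), θ x ![u] = 0 →
    (∀ v : TangentSpace I x, θ x ![v] = 0 → extD θ x ![u, v] = 0) → u = 0
  smooth_Z : IsSmoothField Z
  θ_Z : ∀ x, θ x ![Z x] = 1
  dθ_Z : ∀ (x : M) (v : TangentSpace I x), extD θ x ![Z x, v] = 0
  smooth_J : ∀ X : (∀ x : M, TangentSpace I x), IsSmoothField X →
    IsSmoothField fun x => J x (X x)
  J_mem : ∀ (x : M) (u : TangentSpace I x), θ x ![u] = 0 → θ x ![J x u] = 0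
  J_J : ∀ (x : M) (u : TangentSpace I x), θ x ![u] = 0 → J x (J x u) = -u
  J_Z : ∀ x, J x (Z x) = 0
  levi_symm : ∀ (x : M) (u v : TangentSpace I x), θ x ![u] = 0 → θ x ![v] = 0 →
    extD θ x ![u, J x v] = extD θ x ![v, J x u]
  levi_pos : ∀ (x : M) (u : TangentSpace I x), θ x ![u] = 0 → u ≠ 0 →
    0 < extD θ x ![u, J x u]
  nijenhuis : ∀ X Y : (∀ x : M, TangentSpace I x), IsSmoothField X → IsSmoothField Y →
    (∀ x, θ x ![X x] = 0) → (∀ x, θ x ![Y x] = 0) → ∀ x,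
      VectorField.mlieBracket I X Y x
        - VectorField.mlieBracket I (fun y => J y (X y)) (fun y => J y (Y y)) x
        + J x (VectorField.mlieBracket I (fun y => J y (X y)) Y x
          + VectorField.mlieBracket I X (fun y => J y (Y y)) x) = 0
  lie_J : ∀ X : (∀ x : M, TangentSpace I x), IsSmoothField X → (∀ x, θ x ![X x] = 0) → ∀ x,
    VectorField.mlieBracket I Z (fun y => J y (X y)) x = J x (VectorField.mlieBracket I Z X x)

/-- The Levi form `h^θ(u, v) = dθ(u, J v)`. -/
def SasakiManifold.levi [IsManifold I ∞ M] (𝒮 : SasakiManifold I M) (x : M)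
    (u v : TangentSpace I x) : ℝ :=
  extD 𝒮.θ x ![u, 𝒮.J x v]

/-- Regularity: the Reeb field is complete and generates a free and proper action of a
one-parameter group `ℝ / Tℤ` (which is `ℝ` for `T = 0` and a circle otherwise). -/
def SasakiManifold.IsRegular [IsManifold I ∞ M] (𝒮 : SasakiManifold I M) : Prop :=
  ∃ (T : ℝ) (_ : AddAction (AddCircle T) M), ProperVAdd (AddCircle T) M ∧
    (∀ (a : AddCircle T) (x : M), a +ᵥ x = x → a = 0) ∧
    ∀ x : M, IsMIntegralCurve (I := I) (fun t : ℝ => (t : AddCircle T) +ᵥ x) 𝒮.Z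

end Fields

/-! ### Kähler manifolds and the Kähler quotient of a regular Sasaki manifold -/

section Kahler

/-- The model space `ℂᵐ` of `m`-dimensional complex manifolds. A complex manifold modelled on it
is also a real manifold, with the model `𝓘(ℝ, Cn m)` and the same charts. -/
abbrev Cn (m : ℕ) := EuclideanSpace ℂ (Fin m)

variable {m : ℕ} {N : Type*} [TopologicalSpace N] [ChartedSpace (Cn m) N]

/-- The complex structure `J^N` of a complex manifold: multiplication by `i` in holomorphic
charts. -/
def complexStructure (y : N) : TangentSpace 𝓘(ℝ, Cn m) y →L[ℝ] TangentSpace 𝓘(ℝ, Cn m) y :=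
  (Complex.I • ContinuousLinearMap.id ℝ (Cn m) : Cn m →L[ℝ] Cn m)

variable (m N) in
/-- A Kähler metric on a complex manifold: a Hermitian Riemannian metric `g` with closed Kähler
form `κ = g(J·, ·)`, i.e. `g = κ(·, J·)`. -/
structure KahlerMetric where
  /-- the Riemannian metric -/
  g : BilinField 𝓘(ℝ, Cn m) N
  /-- the Kähler form -/
  κ : DiffForm 𝓘(ℝ, Cn m) N ℝ 2
  smooth : IsSmoothBilin g
  symm : ∀ y u v, g y u v = g y v u
  pos : ∀ y u, u ≠ 0 → 0 < g y u u
  hermitian : ∀ y u v, g y (complexStructure y u) (complexStructure y v) = g y u v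
  κ_eq : ∀ y u v, κ y ![u, v] = g y (complexStructure y u) v
  closed : ∀ y, extD κ y = 0

/-- Nowhere vanishing holomorphic `(m, 0)`-forms on an `m`-dimensional complex manifold. -/
structure IsHolomorphicVolumeForm (Ω : DiffForm 𝓘(ℂ, Cn m) N ℂ m) : Prop where
  holomorphic : IsSmoothForm Ω
  ne_zero : ∀ y, Ω y ≠ 0

variable {E : Type*} [NormedAddCommGroup E] [NormedSpace ℝ E] {H : Type*} [TopologicalSpace H]
  {I : ModelWithCorners ℝ E H} {S : Type*} [TopologicalSpace S] [ChartedSpace H S]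
  [IsManifold I ∞ S]

/-- `(N, J^N, g^N)` is the Kähler manifold associated with the Sasaki manifold `S`, with
projection `π`: `π` is a surjective submersion whose fibres are the orbits of the Reeb field (so
that `N` is the orbit space), it sends `J` to `J^N`, and `π^* g^N` is the Levi form on
`𝒟 = ker θ`; then also `π^* κ = dθ`. -/
structure IsAssociatedKahler (𝒮 : SasakiManifold I S) (K : KahlerMetric m N) (π : S → N) :
    Prop where
  smooth : ContMDiff I 𝓘(ℝ, Cn m) ∞ π
  surjective : Function.Surjective π
  submersion : ∀ x, Function.Surjective (mfderiv I 𝓘(ℝ, Cn m) π x)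
  fibres : ∀ x y, π x = π y ↔
    ∃ γ : ℝ → S, IsMIntegralCurve (I := I) γ 𝒮.Z ∧ γ 0 = x ∧ ∃ t, γ t = y
  complex : ∀ (x : S) (u : TangentSpace I x), 𝒮.θ x ![u] = 0 →
    mfderiv I 𝓘(ℝ, Cn m) π x (𝒮.J x u) = complexStructure (π x) (mfderiv I 𝓘(ℝ, Cn m) π x u)
  metric : ∀ (x : S) (u v : TangentSpace I x), 𝒮.θ x ![u] = 0 → 𝒮.θ x ![v] = 0 →
    K.g (π x) (mfderiv I 𝓘(ℝ, Cn m) π x u) (mfderiv I 𝓘(ℝ, Cn m) π x v) = 𝒮.levi x u v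

end Kahler

/-! ### Metrics of Kähler–Sasaki type on the trivial bundle `M = ℝ × S` -/

section KahlerSasaki

variable {E : Type*} [NormedAddCommGroup E] [NormedSpace ℝ E] {H : Type*} [TopologicalSpace H]
  {I : ModelWithCorners ℝ E H} {S : Type*} [TopologicalSpace S] [ChartedSpace H S]

/-- The velocity field `∂/∂t` of the action of `ℝ` on `ℝ × S` by translations. -/
def fundamentalField (x : ℝ × S) : TangentSpace (𝓘(ℝ, ℝ).prod I) x :=
  mfderiv 𝓘(ℝ, ℝ) (𝓘(ℝ, ℝ).prod I) (fun t : ℝ => (t, x.2)) x.1 (1 : ℝ)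

/-- The differential of the projection `ℝ × S → S`. -/
def projDeriv (x : ℝ × S) : TangentSpace (𝓘(ℝ, ℝ).prod I) x →L[ℝ] TangentSpace I x.2 :=
  mfderiv (𝓘(ℝ, ℝ).prod I) I (Prod.snd : ℝ × S → S) x

/-- Lorentzian metrics of Kähler–Sasaki type on the trivial bundle `pr : ℝ × S → S` over a
(regular) Sasaki manifold `(S, 𝒟 = ker θ, J)`. The Robinson–Trautman structure with associated
subconformal structure `(𝒟, [h^θ])` on `S` is `(𝒲, [h]) = (pr_*⁻¹ 𝒟, [pr^* h^θ])`, and `g` is a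
compatible metric: the orthogonal complement of `p = ∂/∂t` is `𝒲`, and the restriction of `g` to
`𝒲` lies in the conformal class `[h]`. In particular `p` is then a null shearfree field. -/
structure IsKahlerSasakiMetric [IsManifold I ∞ S] {n : ℕ} (𝒮 : SasakiManifold I S)
    (g : LorentzMetric (𝓘(ℝ, ℝ).prod I) (ℝ × S) n) : Prop where
  distribution : ∀ (x : ℝ × S) (v : TangentSpace (𝓘(ℝ, ℝ).prod I) x),
    g.g x (fundamentalField x) v = 0 ↔ 𝒮.θ x.2 ![projDeriv x v] = 0
  conformal : ∃ σ : ℝ × S → ℝ, ContMDiff (𝓘(ℝ, ℝ).prod I) 𝓘(ℝ, ℝ) ∞ σ ∧ (∀ x, 0 < σ x) ∧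
    ∀ (x : ℝ × S) (u v : TangentSpace (𝓘(ℝ, ℝ).prod I) x),
      𝒮.θ x.2 ![projDeriv x u] = 0 → 𝒮.θ x.2 ![projDeriv x v] = 0 →
        g.g x u v = σ x * 𝒮.levi x.2 (projDeriv x u) (projDeriv x v)

end KahlerSasaki

end

/-!
# Plane waves on Lorentzian manifolds of Kähler–Sasaki type

Let `P : ℝ × S → N` be the projection to the Kähler quotient, `q` the pull-back of the contact form
and `α = P^* Ω` the pull-back of the holomorphic volume form. The plane wave is `F = q ∧ Re α`.

*Closedness.* The form `Ω` is closed, being holomorphic of top degree, and so is `α`. Moreover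
`dθ` is the pull-back of the Kähler form (`IsAssociatedKahler.extD_contact_eq`), which is the
antisymmetrisation of a form `k(a, b)` that is complex linear in `b`
(`exists_complexLinear_antisymm`). As `k(a, ·) ∧ Ω` is a complex form of degree `m + 1` on an
`m`-dimensional space, it vanishes, and therefore `d(q ∧ α) = dq ∧ α - q ∧ dα = 0`. This is done in
`extDeriv_covWedge_eq_zero` and `extD_wedge_pullField_eq_zero`; it shows that `q ∧ Re (c α)` is
closed for every constant `c ∈ ℂ`.

*Co-closedness.* The Hodge dual of `q ∧ Re α` is `q ∧ Re (-iᵐ α)`, which is again closed. To see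
this without choosing an adapted frame, let `P♭ = g(∂/∂t, ·)`, which is a multiple of `q`, and let
`dt` be the coordinate differential. The `m + 1` complex covectors `(P♭, dz₁, …, dzₘ)` pulled back
to a tangent space span a maximal isotropic subspace, because `g` is a multiple of a Hermitian
scalar product on the orthogonal complement of `∂/∂t`. For a maximal isotropic subspace the
complementary maximal minors in an orthonormal basis are proportional
(`Matrix.det_mul_det_of_isotropic`), and the factor is the determinant of the coframe
`(P♭, dz, dt, conj dz)`, whose square is known up to a positive factor
(`Matrix.sq_det_of_isotropic`). Since the components of `q ∧ Re (c α)` are such minors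
(`wedge_reForm_apply`), this is the duality (`IsTransverselyHermitian.isHodgeDual`).

*Orientation.* The determinant of the coframe, multiplied by `|Ω|²`, is up to a power of `i` the
global smooth top-degree form `orientForm`. It does not vanish, and so it can be rescaled to a
volume form (`LorentzMetric.exists_isVolumeForm`).

Finally, `F` does not vanish since `q` and the components of `α` are independent, and a null vector
in the kernel of `q` is mapped to zero by `dP`, because `g` is positive definite there modulo
`∂/∂t`.
-/

noncomputable section

/-! ### The wedge product and determinants -/

section Wedge

variable {V : Type*} [AddCommGroup V] [Module ℝ V] [TopologicalSpace V]

/-- The wedge product as a normalised sum over all permutations. -/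
theorem wedge_apply {p q : ℕ} (a : V [⋀^Fin p]→L[ℝ] ℝ) (b : V [⋀^Fin q]→L[ℝ] ℝ)
    (v : Fin (p + q) → V) :
    wedge a b v = ((p.factorial * q.factorial : ℕ) : ℝ)⁻¹ *
      ∑ σ : Equiv.Perm (Fin p ⊕ Fin q), ((Equiv.Perm.sign σ : ℤ) : ℝ) *
        (a (fun i => v (finSumFinEquiv (σ (Sum.inl i)))) *
          b (fun i => v (finSumFinEquiv (σ (Sum.inr i))))) := by
  have h := congrArg (fun f => LinearMap.mul' ℝ ℝ (f (fun i => v (finSumFinEquiv i))))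
    (MultilinearMap.domCoprod_alternization_eq a.toAlternatingMap b.toAlternatingMap)
  have h2 : LinearMap.mul' ℝ ℝ ((a.toAlternatingMap.domCoprod b.toAlternatingMap)
      (fun i => v (finSumFinEquiv i))) = wedge a b v := rfl
  simp only [MultilinearMap.alternatization_apply, map_sum, AlternatingMap.smul_apply, map_nsmul,
    h2, Fintype.card_fin] at h
  rw [eq_inv_mul_iff_mul_eq₀ (by positivity), ← nsmul_eq_mul, ← h]
  refine Finset.sum_congr rfl fun σ _ => ?_
  simp only [Units.smul_def]
  rw [map_zsmul, zsmul_eq_mul]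
  rfl

theorem det_eq_sum_rows {ι R : Type*} [Fintype ι] [DecidableEq ι] [CommRing R]
    (A : Matrix ι ι R) :
    A.det = ∑ τ : Equiv.Perm ι, ((Equiv.Perm.sign τ : ℤ) : R) * ∏ i, A i (τ i) := by
  rw [← Matrix.det_transpose, Matrix.det_apply']
  rfl

/-- Laplace expansion of a determinant along a block of rows, as a sum over all permutations
instead of shuffles. -/
theorem sum_perm_det_mul_det {ι κ R : Type*} [Fintype ι] [DecidableEq ι] [Fintype κ]
    [DecidableEq κ] [CommRing R] (M : Matrix (ι ⊕ κ) (ι ⊕ κ) R) :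
    ∑ σ : Equiv.Perm (ι ⊕ κ), ((Equiv.Perm.sign σ : ℤ) : R) *
      ((M.submatrix Sum.inl (fun i => σ (Sum.inl i))).det *
        (M.submatrix Sum.inr (fun i => σ (Sum.inr i))).det) =
    (((Fintype.card ι).factorial * (Fintype.card κ).factorial : ℕ) : R) * M.det := by
  have key : ∀ (τ₁ : Equiv.Perm ι) (τ₂ : Equiv.Perm κ),
      ∑ σ : Equiv.Perm (ι ⊕ κ), ((Equiv.Perm.sign σ : ℤ) : R) *
        ((((Equiv.Perm.sign τ₁ : ℤ) : R) * ∏ i, M (Sum.inl i) (σ (Sum.inl (τ₁ i)))) *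
        (((Equiv.Perm.sign τ₂ : ℤ) : R) * ∏ i, M (Sum.inr i) (σ (Sum.inr (τ₂ i))))) = M.det := by
    intro τ₁ τ₂
    symm
    rw [← Matrix.det_transpose, Matrix.det_apply',
      ← Equiv.sum_comp (Equiv.mulRight (Equiv.sumCongr τ₁ τ₂))]
    refine Finset.sum_congr rfl fun σ _ => ?_
    have h : Equiv.Perm.sign (Equiv.sumCongr τ₁ τ₂) = Equiv.Perm.sign τ₁ * Equiv.Perm.sign τ₂ :=
      Equiv.Perm.sign_sumCongr τ₁ τ₂
    simp only [Equiv.coe_mulRight, Equiv.Perm.sign_mul, h, Fintype.prod_sum_type,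
      Matrix.transpose_apply, Equiv.Perm.mul_apply, Equiv.sumCongr_apply, Sum.map_inl, Sum.map_inr]
    push_cast
    ring
  calc _ = ∑ σ : Equiv.Perm (ι ⊕ κ), ∑ τ₁ : Equiv.Perm ι, ∑ τ₂ : Equiv.Perm κ,
        ((Equiv.Perm.sign σ : ℤ) : R) *
        ((((Equiv.Perm.sign τ₁ : ℤ) : R) * ∏ i, M (Sum.inl i) (σ (Sum.inl (τ₁ i)))) *
        (((Equiv.Perm.sign τ₂ : ℤ) : R) * ∏ i, M (Sum.inr i) (σ (Sum.inr (τ₂ i))))) := by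
        refine Finset.sum_congr rfl fun σ _ => ?_
        rw [det_eq_sum_rows, det_eq_sum_rows, Finset.sum_mul_sum, Finset.mul_sum]
        refine Finset.sum_congr rfl fun τ₁ _ => ?_
        rw [Finset.mul_sum]
        rfl
    _ = ∑ τ₁ : Equiv.Perm ι, ∑ τ₂ : Equiv.Perm κ, M.det := by
        rw [Finset.sum_comm]
        refine Finset.sum_congr rfl fun τ₁ _ => ?_
        rw [Finset.sum_comm]
        exact Finset.sum_congr rfl fun τ₂ _ => key τ₁ τ₂
    _ = _ := by
        simp [Fintype.card_perm, mul_assoc]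

/-- Every injective map `ι → ι ⊕ κ` extends to `|κ|!` permutations of `ι ⊕ κ`. -/
theorem sum_perm_comp_inl {ι κ R : Type*} [Fintype ι] [DecidableEq ι] [Fintype κ]
    [DecidableEq κ] [CommRing R] (f : (ι → ι ⊕ κ) → R)
    (hf : ∀ s, ¬ Function.Injective s → f s = 0) :
    ∑ σ : Equiv.Perm (ι ⊕ κ), f (fun i => σ (Sum.inl i)) =
      ((Fintype.card κ).factorial : R) * ∑ s, f s := by
  classical
  rw [← Finset.sum_fiberwise (s := Finset.univ)
    (g := fun σ : Equiv.Perm (ι ⊕ κ) => fun i => σ (Sum.inl i)), Finset.mul_sum]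
  refine Finset.sum_congr rfl fun s _ => ?_
  rw [Finset.sum_congr rfl (g := fun _ => f s) (fun σ hσ => by rw [(Finset.mem_filter.1 hσ).2]),
    Finset.sum_const, nsmul_eq_mul]
  by_cases hs : Function.Injective s
  · congr 2
    -- extensions of `s` correspond to bijections between the complements of `ι` and of its image
    let e₀ : Set.range (Sum.inl : ι → ι ⊕ κ) ≃ Set.range s :=
      (Equiv.ofInjective _ Sum.inl_injective).symm.trans (Equiv.ofInjective s hs)
    have h0 : ∀ i, (e₀ ⟨Sum.inl i, i, rfl⟩ : ι ⊕ κ) = s i := by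
      intro i
      have : (Equiv.ofInjective _ (Sum.inl_injective (α := ι) (β := κ))).symm ⟨Sum.inl i, i, rfl⟩
          = i := by
        rw [Equiv.symm_apply_eq]; rfl
      simp only [e₀, Equiv.trans_apply, this]
      rfl
    have h1 : (Finset.univ.filter fun σ : Equiv.Perm (ι ⊕ κ) => (fun i => σ (Sum.inl i)) = s).card
        = Fintype.card {e : ι ⊕ κ ≃ ι ⊕ κ // ∀ x : Set.range (Sum.inl : ι → ι ⊕ κ),
            e x = e₀ x} := by
      rw [Fintype.card_subtype]
      congr 1
      ext σ
      simp only [Finset.mem_filter, Finset.mem_univ, true_and]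
      constructor
      · rintro h ⟨_, i, rfl⟩
        rw [h0, ← h]
      · intro h
        ext1 i
        rw [← h0, ← h]
    have h2 : Fintype.card ((Set.range (Sum.inl : ι → ι ⊕ κ))ᶜ : Set (ι ⊕ κ)) =
        Fintype.card κ := by
      rw [Fintype.card_compl_set, Set.card_range_of_injective Sum.inl_injective]
      simp
    have h3 : Fintype.card ((Set.range s)ᶜ : Set (ι ⊕ κ)) = Fintype.card κ := by
      rw [Fintype.card_compl_set, Set.card_range_of_injective hs]
      simp
    rw [h1, Fintype.card_congr (Equiv.Set.compl e₀),
      Fintype.card_equiv (Fintype.equivOfCardEq (h2.trans h3.symm)), h2]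
  · rw [hf s hs, mul_zero, mul_zero]

end Wedge

section Jacobi
open Matrix

/-- Complementary minors: if the rows `B = [B₁ B₂]` are isotropic for the diagonal bilinear form
`(η₁, η₂)` and `D` is their pairing with the rows `C = [C₁ C₂]`, then the two complementary
maximal minors of `B` are proportional. -/
theorem Matrix.det_mul_det_of_isotropic {ι R : Type*} [Fintype ι] [DecidableEq ι] [CommRing R]
    (B₁ B₂ C₁ C₂ D : Matrix ι ι R) (η₁ η₂ : ι → R)
    (hB : B₁ * diagonal η₁ * B₁ᵀ + B₂ * diagonal η₂ * B₂ᵀ = 0)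
    (hD : B₁ * diagonal η₁ * C₁ᵀ + B₂ * diagonal η₂ * C₂ᵀ = D) :
    B₁.det * D.det = (fromBlocks B₁ B₂ C₁ C₂).det * ((∏ i, η₂ i) * B₂.det) := by
  have hD' : C₁ * (diagonal η₁ * B₁ᵀ) + C₂ * (diagonal η₂ * B₂ᵀ) = Dᵀ := by
    rw [← hD]
    simp [Matrix.transpose_mul, Matrix.mul_assoc]
  -- multiplication by the `η`-dual of `B` in the last columns gives a block triangular matrix
  have h : fromBlocks B₁ B₂ C₁ C₂ *
      fromBlocks 1 (diagonal η₁ * B₁ᵀ) 0 (diagonal η₂ * B₂ᵀ) = fromBlocks B₁ 0 C₁ Dᵀ := by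
    rw [fromBlocks_multiply]
    simp only [Matrix.mul_one, Matrix.mul_zero, add_zero, hD']
    simp only [← Matrix.mul_assoc, hB]
  have h' := congrArg Matrix.det h
  rw [det_mul, det_fromBlocks_zero₂₁, det_fromBlocks_zero₁₂, det_mul, det_diagonal] at h'
  simp only [det_one, one_mul, det_transpose] at h'
  exact h'.symm

/-- The square of the determinant of the rows `B` and `C` with respect to the form `(η₁, η₂)`. -/
theorem Matrix.sq_det_of_isotropic {ι R : Type*} [Fintype ι] [DecidableEq ι] [CommRing R]
    (B₁ B₂ C₁ C₂ D : Matrix ι ι R) (η₁ η₂ : ι → R)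
    (hB : B₁ * diagonal η₁ * B₁ᵀ + B₂ * diagonal η₂ * B₂ᵀ = 0)
    (hD : B₁ * diagonal η₁ * C₁ᵀ + B₂ * diagonal η₂ * C₂ᵀ = D) :
    (fromBlocks B₁ B₂ C₁ C₂).det ^ 2 * ((∏ i, η₁ i) * ∏ i, η₂ i) =
      (-1) ^ Fintype.card ι * D.det ^ 2 := by
  have hD' : C₁ * (diagonal η₁ * B₁ᵀ) + C₂ * (diagonal η₂ * B₂ᵀ) = Dᵀ := by
    rw [← hD]
    simp [Matrix.transpose_mul, Matrix.mul_assoc]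
  have h : fromBlocks B₁ B₂ C₁ C₂ * fromBlocks (diagonal η₁) 0 0 (diagonal η₂) *
      (fromBlocks B₁ B₂ C₁ C₂)ᵀ = fromBlocks 0 D Dᵀ
        (C₁ * diagonal η₁ * C₁ᵀ + C₂ * diagonal η₂ * C₂ᵀ) := by
    rw [fromBlocks_transpose, fromBlocks_multiply, fromBlocks_multiply]
    simp only [Matrix.mul_zero, add_zero, zero_add, hB, hD]
    simp only [← hD', Matrix.mul_assoc]
  have h' := congrArg Matrix.det h
  have hsw : (fromBlocks 0 D Dᵀ (C₁ * diagonal η₁ * C₁ᵀ + C₂ * diagonal η₂ * C₂ᵀ)).det =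
      (-1) ^ Fintype.card ι * D.det ^ 2 := by
    -- interchange the two blocks of columns
    have : fromBlocks 0 D Dᵀ (C₁ * diagonal η₁ * C₁ᵀ + C₂ * diagonal η₂ * C₂ᵀ) =
        fromBlocks D 0 (C₁ * diagonal η₁ * C₁ᵀ + C₂ * diagonal η₂ * C₂ᵀ) Dᵀ *
          fromBlocks 0 1 1 0 := by
      rw [fromBlocks_multiply]; simp
    rw [this, det_mul, det_fromBlocks_zero₁₂, det_transpose]
    have : (fromBlocks 0 1 1 0 : Matrix (ι ⊕ ι) (ι ⊕ ι) R).det = (-1) ^ Fintype.card ι := by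
      have h2 : (fromBlocks 0 1 1 0 : Matrix (ι ⊕ ι) (ι ⊕ ι) R) =
          fromBlocks 1 1 0 1 * fromBlocks (-1) 0 1 1 * fromBlocks 1 (-1) 0 1 := by
        rw [fromBlocks_multiply, fromBlocks_multiply]; simp
      rw [h2, det_mul, det_mul]
      simp [det_neg]
    rw [this]; ring
  rw [det_mul, det_mul, det_transpose, det_fromBlocks_zero₂₁, det_diagonal, det_diagonal,
    hsw] at h'
  rw [← h']; ring

end Jacobi

/-! ### Pull-backs of complex volume forms -/

section Covectors

variable {V : Type*} [AddCommGroup V] [Module ℝ V] [TopologicalSpace V]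

/-- The linear functional underlying a `1`-form. -/
def oneFormLin (q : V [⋀^Fin 1]→L[ℝ] ℝ) : V →ₗ[ℝ] ℝ where
  toFun v := q ![v]
  map_add' u v := q.vecCons_add ![] u v
  map_smul' c v := q.vecCons_smul ![] c v

@[simp] theorem oneFormLin_apply (q : V [⋀^Fin 1]→L[ℝ] ℝ) (v : V) : oneFormLin q v = q ![v] := rfl

/-- The real part `Re (c α)` of a complex multiple of a complex-valued form. -/
def reForm {n : ℕ} (c : ℂ) (α : V [⋀^Fin n]→L[ℝ] ℂ) : V [⋀^Fin n]→L[ℝ] ℝ :=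
  (Complex.reCLM ∘L (c • ContinuousLinearMap.id ℝ ℂ)).compContinuousAlternatingMap α

@[simp] theorem reForm_apply {n : ℕ} (c : ℂ) (α : V [⋀^Fin n]→L[ℝ] ℂ) (v : Fin n → V) :
    reForm c α v = (c * α v).re := rfl

/-- The pull-back of a complex multilinear form on `ℂᵐ` by a real linear map. -/
def pullForm {m n : ℕ} (Ω : Cn m [⋀^Fin n]→L[ℂ] ℂ) (L : V →L[ℝ] Cn m) : V [⋀^Fin n]→L[ℝ] ℂ :=
  (Ω.restrictScalars ℝ).compContinuousLinearMap L

@[simp] theorem pullForm_apply {m n : ℕ} (Ω : Cn m [⋀^Fin n]→L[ℂ] ℂ) (L : V →L[ℝ] Cn m)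
    (v : Fin n → V) : pullForm Ω L v = Ω fun i => L (v i) := rfl

/-- The value of a complex `m`-form on the standard basis of `ℂᵐ`. -/
def topCoeff {m : ℕ} (Ω : Cn m [⋀^Fin m]→L[ℂ] ℂ) : ℂ :=
  Ω fun i => EuclideanSpace.single i (1 : ℂ)

theorem apply_eq_topCoeff_mul_det {m : ℕ} (Ω : Cn m [⋀^Fin m]→L[ℂ] ℂ) (v : Fin m → Cn m) :
    Ω v = topCoeff Ω * (Matrix.of fun i j => v j i).det := by
  have h := congrArg (fun f => f v)
    (Ω.toAlternatingMap.eq_smul_basis_det (EuclideanSpace.basisFun (Fin m) ℂ).toBasis)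
  simp only [ContinuousAlternatingMap.coe_toAlternatingMap, AlternatingMap.smul_apply,
    smul_eq_mul] at h
  rw [h]
  congr 1
  · rw [topCoeff]
    congr 1
    ext1 i
    simp

theorem topCoeff_ne_zero {m : ℕ} {Ω : Cn m [⋀^Fin m]→L[ℂ] ℂ} (h : Ω ≠ 0) : topCoeff Ω ≠ 0 := by
  contrapose! h
  ext v
  rw [apply_eq_topCoeff_mul_det, h]
  simp

/-- The complex covectors `(q, L₁, …, Lₘ)`. -/
def covRow {m : ℕ} (q : V [⋀^Fin 1]→L[ℝ] ℝ) (L : V →L[ℝ] Cn m) (i : Fin (1 + m)) (v : V) : ℂ :=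
  Sum.elim (fun _ => ((q ![v] : ℝ) : ℂ)) (fun k => L v k) (finSumFinEquiv.symm i)

/-- The values of the covectors `covRow q L` on the vectors `w`. -/
def covMatrix {m : ℕ} {κ : Type*} (q : V [⋀^Fin 1]→L[ℝ] ℝ) (L : V →L[ℝ] Cn m) (w : κ → V) :
    Matrix (Fin (1 + m)) κ ℂ :=
  Matrix.of fun i j => covRow q L i (w j)

/-- The components of `q ∧ Re (c α)`, for the pull-back `α` of a complex volume form, are given by
the maximal minors of the matrix of covectors `(q, L₁, …, Lₘ)`. -/
theorem wedge_reForm_apply {m : ℕ} (q : V [⋀^Fin 1]→L[ℝ] ℝ) (L : V →L[ℝ] Cn m)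
    (Ω : Cn m [⋀^Fin m]→L[ℂ] ℂ) (c : ℂ) (v : Fin (1 + m) → V) :
    wedge q (reForm c (pullForm Ω L)) v = (c * topCoeff Ω * (covMatrix q L v).det).re := by
  have h := sum_perm_det_mul_det ((covMatrix q L v).submatrix finSumFinEquiv finSumFinEquiv)
  rw [Matrix.det_submatrix_equiv_self, Fintype.card_fin, Fintype.card_fin] at h
  rw [wedge_apply, inv_mul_eq_iff_eq_mul₀ (by positivity)]
  have h2 := congrArg (fun z => (c * topCoeff Ω * z).re) h
  rw [mul_left_comm, ← Complex.ofReal_natCast, Complex.re_ofReal_mul] at h2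
  rw [← h2, Finset.mul_sum, Complex.re_sum]
  refine Finset.sum_congr rfl fun σ _ => ?_
  rw [reForm_apply, pullForm_apply, apply_eq_topCoeff_mul_det, mul_left_comm (c * topCoeff Ω),
    ← Complex.ofReal_intCast, Complex.re_ofReal_mul]
  congr 1
  rw [mul_left_comm (c * topCoeff Ω)]
  have h3 : (((covMatrix q L v).submatrix finSumFinEquiv finSumFinEquiv).submatrix Sum.inl
      fun i => σ (Sum.inl i)).det =
      ((q fun i => v (finSumFinEquiv (σ (Sum.inl i))) : ℝ) : ℂ) := by
    rw [Matrix.det_unique]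
    simp only [covMatrix, covRow, Matrix.submatrix_apply, Matrix.of_apply,
      Equiv.symm_apply_apply, Sum.elim_inl]
    congr 2
    ext1 i
    fin_cases i
    rfl
  rw [h3, Complex.re_ofReal_mul, ← mul_assoc c]
  congr 4
  ext i j
  simp [covMatrix, covRow]

end Covectors

/-! ### Orthonormal bases and the Hodge operator -/

section LorentzBasis

variable {V : Type*} [AddCommGroup V] [Module ℝ V] [TopologicalSpace V]

theorem lorentzSign_mul_self {n : ℕ} (i : Fin n) : lorentzSign i * lorentzSign i = 1 := by
  unfold lorentzSign; split_ifs <;> norm_num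

theorem prod_lorentzSign {n : ℕ} (hn : 0 < n) : ∏ i : Fin n, lorentzSign i = -1 := by
  obtain ⟨k, rfl⟩ := Nat.exists_eq_succ_of_ne_zero hn.ne'
  rw [Fin.prod_univ_succ]
  simp [lorentzSign]

variable {n : ℕ} {g : V →L[ℝ] V →L[ℝ] ℝ} {e : Module.Basis (Fin n) ℝ V}

theorem IsLorentzBasis.sum_smul (he : IsLorentzBasis g e) (x : V) :
    ∑ j, (lorentzSign j * g x (e j)) • e j = x := by
  conv_rhs => rw [← e.sum_repr x]
  refine Finset.sum_congr rfl fun j _ => ?_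
  congr 1
  have h : g x (e j) = ∑ i, e.repr x i * g (e i) (e j) := by
    conv_lhs => rw [← e.sum_repr x]
    rw [map_sum, sum_apply]
    simp only [map_smul, smul_apply, smul_eq_mul]
  have h' : g x (e j) = e.repr x j * lorentzSign j := by simp [h, he _ j]
  rw [h', mul_left_comm, lorentzSign_mul_self, mul_one]

theorem IsLorentzBasis.symm (he : IsLorentzBasis g e) (x y : V) : g x y = g y x := by
  have h : (g : V →L[ℝ] V →L[ℝ] ℝ).toLinearMap₁₂ = g.toLinearMap₁₂.flip := by
    refine LinearMap.ext_basis e e fun i j => ?_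
    change g (e i) (e j) = g (e j) (e i)
    rw [he, he]
    by_cases hij : i = j
    · subst hij; rfl
    · rw [if_neg hij, if_neg (Ne.symm hij)]
  exact congrArg (fun f => f x y) h

theorem IsLorentzBasis.exists_dual (he : IsLorentzBasis g e) (β : V →ₗ[ℝ] ℝ) :
    ∃ x, ∀ v, g x v = β v := by
  refine ⟨∑ j, (lorentzSign j * β (e j)) • e j, fun v => ?_⟩
  have h : ((g (∑ j, (lorentzSign j * β (e j)) • e j) : V →L[ℝ] ℝ) : V →ₗ[ℝ] ℝ) = β := by
    refine e.ext fun i => ?_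
    simp [he _ i, mul_right_comm, lorentzSign_mul_self]
  exact congrArg (fun f => f v) h

/-- The scalar product of the covectors `β` and `b`, computed in an orthonormal basis on the left,
is the value of `b` on the vector dual to `β`. -/
theorem IsLorentzBasis.pair_eq (he : IsLorentzBasis g e) {β : V → ℝ} {x : V}
    (hx : ∀ v, g x v = β v) (b : V →ₗ[ℝ] ℂ) :
    ∑ j, (lorentzSign j : ℂ) * (β (e j) : ℂ) * b (e j) = b x := by
  conv_rhs => rw [← he.sum_smul x]
  rw [map_sum]
  refine Finset.sum_congr rfl fun j _ => ?_
  rw [map_smul, hx, Complex.real_smul]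
  push_cast
  ring

end LorentzBasis

section Hodge

variable {V : Type*} [AddCommGroup V] [Module ℝ V] [TopologicalSpace V]

/-- To verify that `c` is the Hodge dual of `b` in the middle degree, it suffices to compare, in
each orthonormal basis, the complementary components of `b` and `c`. -/
theorem wedge_eq_formInner_smul {p : ℕ} (e : Module.Basis (Fin (p + p)) ℝ V)
    (vol : V [⋀^Fin (p + p)]→L[ℝ] ℝ) (b c : V [⋀^Fin p]→L[ℝ] ℝ)
    (h : ∀ σ : Equiv.Perm (Fin p ⊕ Fin p),
      ((Equiv.Perm.sign σ : ℤ) : ℝ) * c (fun i => e (finSumFinEquiv (σ (Sum.inr i)))) =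
        vol e * ((∏ i, lorentzSign (finSumFinEquiv (σ (Sum.inl i)))) *
          b (fun i => e (finSumFinEquiv (σ (Sum.inl i))))))
    (a : V [⋀^Fin p]→L[ℝ] ℝ) : wedge a c = formInner e a b • vol := by
  have key : wedge a c e = formInner e a b * vol e := by
    rw [wedge_apply, formInner]
    let f : (Fin p → Fin p ⊕ Fin p) → ℝ := fun s =>
      vol e * ((∏ i, lorentzSign (finSumFinEquiv (s i))) *
        a (fun i => e (finSumFinEquiv (s i))) * b (fun i => e (finSumFinEquiv (s i))))
    have h1 : ∀ σ : Equiv.Perm (Fin p ⊕ Fin p), ((Equiv.Perm.sign σ : ℤ) : ℝ) *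
        (a (fun i => e (finSumFinEquiv (σ (Sum.inl i)))) *
          c (fun i => e (finSumFinEquiv (σ (Sum.inr i))))) =
        f (fun i => σ (Sum.inl i)) := by
      intro σ
      simp only [f]
      rw [mul_left_comm, h σ]
      ring
    rw [Finset.sum_congr rfl fun σ _ => h1 σ, sum_perm_comp_inl f, ← Finset.mul_sum,
      Fintype.card_fin, ← Equiv.sum_comp ((Equiv.refl (Fin p)).arrowCongr
        (finSumFinEquiv : Fin p ⊕ Fin p ≃ Fin (p + p)))]
    · have : (p.factorial : ℝ) ≠ 0 := by exact_mod_cast p.factorial_ne_zero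
      simp only [Equiv.arrowCongr_apply, Equiv.refl_symm, Equiv.coe_refl, Function.comp_apply,
        id]
      push_cast
      field_simp
    · intro s hs
      have : a (fun i => e (finSumFinEquiv (s i))) = 0 := by
        refine a.map_eq_zero_of_not_injective _ fun hinj => hs fun i j hij => hinj ?_
        simp only [hij]
      simp only [f, this]; simp
  ext v
  have h1 := congrArg (fun f => f v) ((wedge a c).toAlternatingMap.eq_smul_basis_det e)
  have h2 := congrArg (fun f => f v) (vol.toAlternatingMap.eq_smul_basis_det e)
  simp only [ContinuousAlternatingMap.coe_toAlternatingMap, AlternatingMap.smul_apply,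
    smul_eq_mul] at h1 h2
  rw [ContinuousAlternatingMap.smul_apply, smul_eq_mul, h1, h2, key, mul_assoc]

end Hodge

/-! ### The null coframe of a Kähler–Sasaki tangent space -/

section Transverse

open scoped ComplexOrder

/-- Let `u₁, …, uₘ` be the vectors dual to the real parts of the coordinates for the real part `k`
of a Hermitian scalar product on `ℂᵐ`. Their components form a positive definite matrix: it is the
inverse, up to conjugation, of the matrix of the Hermitian scalar product. -/
theorem posDef_of_dual {m : ℕ} (k : Cn m →L[ℝ] Cn m →L[ℝ] ℝ) (hsymm : ∀ x y, k x y = k y x)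
    (hpos : ∀ x, x ≠ 0 → 0 < k x x)
    (hherm : ∀ x y, k (Complex.I • x) (Complex.I • y) = k x y)
    (u : Fin m → Cn m) (hu : ∀ i v, k (u i) v = (v i).re) :
    (Matrix.of fun i j => u j i).PosDef := by
  have hskew : ∀ x y, k (Complex.I • x) y = - k x (Complex.I • y) := by
    intro x y
    rw [← hherm, smul_smul, Complex.I_mul_I, neg_one_smul, map_neg]
    rfl
  have hIu : ∀ i v, k (Complex.I • u i) v = (v i).im := by
    intro i v
    rw [hskew, hu]
    simp
  have hcu : ∀ (c : ℂ) i v, k (c • u i) v = (star c * v i).re := by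
    intro c i v
    have : c • u i = c.re • u i + c.im • (Complex.I • u i) := by
      conv_lhs => rw [← Complex.re_add_im c]
      rw [add_smul, mul_smul]
      rfl
    rw [this, map_add, map_smul, map_smul]
    simp [hu, hIu]
  refine Matrix.PosDef.of_dotProduct_mulVec_pos ?_ fun a ha => ?_
  · ext i j
    simp only [Matrix.conjTranspose_apply, Matrix.of_apply]
    apply Complex.ext
    · simp only [Complex.star_def, Complex.conj_re]
      rw [← hu j, ← hu i, hsymm]
    · simp only [Complex.star_def, Complex.conj_im]
      rw [← hIu j, ← hIu i, hskew, hsymm, neg_neg]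
  · set x : Cn m := ∑ j, a j • u j with hx
    have hval : star a ⬝ᵥ (Matrix.of fun i j => u j i).mulVec a = ∑ i, star (a i) * x i := by
      simp only [dotProduct, Matrix.mulVec, Pi.star_apply, Matrix.of_apply, hx]
      refine Finset.sum_congr rfl fun i _ => ?_
      congr 1
      simp [mul_comm]
    have hkx : ∀ v, k x v = (∑ i, star (a i) * v i).re := by
      intro v
      rw [hx, map_sum, sum_apply, Complex.re_sum]
      exact Finset.sum_congr rfl fun i _ => hcu _ _ _
    have hx0 : x ≠ 0 := by
      intro h0
      refine ha (funext fun i => ?_)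
      have h1 := hkx (EuclideanSpace.single i (a i))
      rw [h0, map_zero] at h1
      simp only [zero_apply, PiLp.single_apply, mul_ite, mul_zero,
        Finset.sum_ite_eq', Finset.mem_univ, if_true] at h1
      rw [Complex.star_def, ← Complex.normSq_eq_conj_mul_self, Complex.ofReal_re] at h1
      simpa using h1.symm
    have him : (∑ i, star (a i) * x i).im = 0 := by
      have h1 := hkx (Complex.I • x)
      have h2 : k x (Complex.I • x) = 0 := by
        have := hskew x x
        rw [hsymm] at this
        linarith
      rw [h2] at h1
      have h3 : ∑ i, star (a i) * (Complex.I • x) i = Complex.I * ∑ i, star (a i) * x i := by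
        rw [Finset.mul_sum]
        refine Finset.sum_congr rfl fun i _ => ?_
        simp [mul_left_comm]
      rw [h3] at h1
      simpa using h1.symm
    rw [hval, Complex.lt_def]
    exact ⟨by rw [← hkx]; simpa using hpos x hx0, by rw [him]; rfl⟩

variable {V : Type*} [AddCommGroup V] [Module ℝ V] [TopologicalSpace V]

/-- The linear algebra of a tangent space of a Lorentzian manifold of Kähler–Sasaki type: `p` is a
null vector with dual covector `P` and `T` is a covector with `T(p) = 1`; on the orthogonal
complement of `p` the scalar product `g` is `s` times the pull-back of the Hermitian scalar
product `k` of `ℂᵐ` by the real linear map `L`. -/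
structure IsTransverselyHermitian {m : ℕ} (g : V →L[ℝ] V →L[ℝ] ℝ) (p : V)
    (P T : V [⋀^Fin 1]→L[ℝ] ℝ) (L : V →L[ℝ] Cn m) (k : Cn m →L[ℝ] Cn m →L[ℝ] ℝ) (s : ℝ) :
    Prop where
  dual : ∀ v, g p v = P ![v]
  null : P ![p] = 0
  T_p : T ![p] = 1
  L_p : L p = 0
  s_pos : 0 < s
  conformal : ∀ u v, P ![u] = 0 → P ![v] = 0 → g u v = s * k (L u) (L v)
  surj : ∀ y, ∃ v, P ![v] = 0 ∧ L v = y
  symm : ∀ x y, k x y = k y x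
  pos : ∀ x, x ≠ 0 → 0 < k x x
  herm : ∀ x y, k (Complex.I • x) (Complex.I • y) = k x y

variable {m : ℕ} {g : V →L[ℝ] V →L[ℝ] ℝ} {p : V} {P T : V [⋀^Fin 1]→L[ℝ] ℝ}
  {L : V →L[ℝ] Cn m} {k : Cn m →L[ℝ] Cn m →L[ℝ] ℝ} {s : ℝ}

/-- The covectors `covRow q L` as linear maps. -/
def covLin (q : V [⋀^Fin 1]→L[ℝ] ℝ) (L : V →L[ℝ] Cn m) (i : Fin (1 + m)) : V →ₗ[ℝ] ℂ :=
  Sum.elim (fun _ => Complex.ofRealCLM.toLinearMap ∘ₗ oneFormLin q)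
    (fun k => ((EuclideanSpace.proj k : Cn m →L[ℂ] ℂ).restrictScalars ℝ).toLinearMap ∘ₗ
      L.toLinearMap) (finSumFinEquiv.symm i)

theorem covLin_apply (q : V [⋀^Fin 1]→L[ℝ] ℝ) (L : V →L[ℝ] Cn m) (i : Fin (1 + m)) (v : V) :
    covLin q L i v = covRow q L i v := by
  obtain ⟨i, rfl⟩ := finSumFinEquiv.surjective i
  rcases i with i | i <;> simp [covLin, covRow]

/-- The vectors `r` and `r'` dual to the real and imaginary parts of the components of `L`. They
project to vectors of `ℂᵐ` that differ by the factor `i`, and so the components of `L` are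
isotropic. -/
theorem IsTransverselyHermitian.exists_dual (h : IsTransverselyHermitian g p P T L k s) {n : ℕ}
    {e : Module.Basis (Fin n) ℝ V} (he : IsLorentzBasis g e) :
    ∃ r r' : Fin m → V, (∀ i v, g (r i) v = (L v i).re) ∧ (∀ i v, g (r' i) v = (L v i).im) ∧
      (∀ i, P ![r i] = 0) ∧ (∀ i, P ![r' i] = 0) ∧ (∀ i, L (r' i) = Complex.I • L (r i)) ∧
      (Matrix.of fun i j => L (r j) i).PosDef := by
  have h1 : ∀ i : Fin m, ∃ x, ∀ v, g x v = (L v i).re := fun i => by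
    simpa using he.exists_dual (Complex.reCLM.toLinearMap ∘ₗ
      ((EuclideanSpace.proj i : Cn m →L[ℂ] ℂ).restrictScalars ℝ).toLinearMap ∘ₗ L.toLinearMap)
  have h2 : ∀ i : Fin m, ∃ x, ∀ v, g x v = (L v i).im := fun i => by
    simpa using he.exists_dual (Complex.imCLM.toLinearMap ∘ₗ
      ((EuclideanSpace.proj i : Cn m →L[ℂ] ℂ).restrictScalars ℝ).toLinearMap ∘ₗ L.toLinearMap)
  choose r hr using h1
  choose r' hr' using h2
  have hPr : ∀ i, P ![r i] = 0 := fun i => by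
    rw [← h.dual, he.symm, hr, h.L_p]; simp
  have hPr' : ∀ i, P ![r' i] = 0 := fun i => by
    rw [← h.dual, he.symm, hr', h.L_p]; simp
  have hk : ∀ i v, (s • k) (L (r i)) v = (v i).re := fun i v => by
    obtain ⟨v, hv, rfl⟩ := h.surj v
    rw [← hr, h.conformal _ _ (hPr i) hv]
    rfl
  have hk' : ∀ i v, (s • k) (L (r' i)) v = (v i).im := fun i v => by
    obtain ⟨v, hv, rfl⟩ := h.surj v
    rw [← hr', h.conformal _ _ (hPr' i) hv]
    rfl
  have hherm : ∀ x y, (s • k) (Complex.I • x) (Complex.I • y) = (s • k) x y := fun x y => by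
    exact congrArg (s * ·) (h.herm x y)
  have hpos : ∀ x, x ≠ 0 → 0 < (s • k) x x := fun x hx => mul_pos h.s_pos (h.pos x hx)
  have hsymm : ∀ x y, (s • k) x y = (s • k) y x := fun x y => by
    exact congrArg (s * ·) (h.symm x y)
  refine ⟨r, r', hr, hr', hPr, hPr', fun i => ?_, posDef_of_dual (s • k) hsymm hpos hherm _ hk⟩
  by_contra hne
  have h0 := hpos _ (sub_ne_zero.2 hne)
  have h3 : ∀ v, (s • k) (L (r' i) - Complex.I • L (r i)) v = 0 := fun v => by
    rw [map_sub, sub_apply, hk', ← hherm, smul_smul, Complex.I_mul_I, neg_one_smul, map_neg,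
      neg_apply, hk]
    simp
  exact h0.ne' (h3 _)

theorem sum_inl_add_sum_inr {n : ℕ} (σ : Equiv.Perm (Fin n ⊕ Fin n)) (f : Fin (n + n) → ℂ) :
    ∑ i, f (finSumFinEquiv (σ (Sum.inl i))) + ∑ i, f (finSumFinEquiv (σ (Sum.inr i))) =
      ∑ l, f l := by
  rw [← Equiv.sum_comp (σ.trans finSumFinEquiv), Fintype.sum_sum_type]
  rfl

/-- The matrix of the covectors `(P, L, T, conj L)` on a family of `2 (m + 1)` vectors. -/
def nullMatrix (P T : V [⋀^Fin 1]→L[ℝ] ℝ) (L : V →L[ℝ] Cn m)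
    (w : Fin (1 + m) ⊕ Fin (1 + m) → V) :
    Matrix (Fin (1 + m) ⊕ Fin (1 + m)) (Fin (1 + m) ⊕ Fin (1 + m)) ℂ :=
  Matrix.fromBlocks (covMatrix P L (w ∘ Sum.inl)) (covMatrix P L (w ∘ Sum.inr))
    ((covMatrix T L (w ∘ Sum.inl)).map star) ((covMatrix T L (w ∘ Sum.inr)).map star)

/-- The null coframe `(P, L, T, conj L)` in a permuted orthonormal basis: the complementary minors
of `(P, L)` are proportional, with a factor given by the determinant of the coframe, and this
determinant is known up to sign. -/
theorem IsTransverselyHermitian.exists_det (h : IsTransverselyHermitian g p P T L k s)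
    {e : Module.Basis (Fin ((1 + m) + (1 + m))) ℝ V} (he : IsLorentzBasis g e) :
    ∃ d : ℝ, 0 < d ∧ ∀ σ : Equiv.Perm (Fin (1 + m) ⊕ Fin (1 + m)),
      (covMatrix P L (fun i => e (finSumFinEquiv (σ (Sum.inl i))))).det * d =
        (nullMatrix P T L (fun j => e (finSumFinEquiv (σ j)))).det *
          ((∏ i, (lorentzSign (finSumFinEquiv (σ (Sum.inr i))) : ℂ)) *
            (covMatrix P L (fun i => e (finSumFinEquiv (σ (Sum.inr i))))).det) ∧
      (nullMatrix P T L (fun j => e (finSumFinEquiv (σ j)))).det ^ 2 = (-1) ^ m * (d : ℂ) ^ 2 := by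
  obtain ⟨r, r', hr, hr', hPr, hPr', hL, hpd⟩ := h.exists_dual he
  -- the scalar products of the covectors `(P, L)` with an arbitrary covector `b`
  have hpair : ∀ i (b : V →ₗ[ℝ] ℂ), ∑ l, (lorentzSign l : ℂ) * covRow P L i (e l) * b (e l) =
      Sum.elim (fun _ => b p) (fun k => b (r k) + Complex.I * b (r' k))
        (finSumFinEquiv.symm i) := by
    intro i b
    obtain ⟨i, rfl⟩ := finSumFinEquiv.surjective i
    rcases i with i | i
    · simp only [covRow, Equiv.symm_apply_apply, Sum.elim_inl]
      exact he.pair_eq h.dual b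
    · simp only [covRow, Equiv.symm_apply_apply, Sum.elim_inr]
      rw [← he.pair_eq (hr i) b, ← he.pair_eq (hr' i) b, Finset.mul_sum, ← Finset.sum_add_distrib]
      refine Finset.sum_congr rfl fun l _ => ?_
      conv_lhs => rw [← Complex.re_add_im (L (e l) i)]
      ring
  -- the pairing of `(P, L)` with `(T, conj L)`, which is block triangular and has `det D > 0`
  set D : Matrix (Fin (1 + m)) (Fin (1 + m)) ℂ := Matrix.of fun i j =>
    ∑ l, (lorentzSign l : ℂ) * covRow P L i (e l) * star (covRow T L j (e l)) with hD
  have hDdet : D.det = (Matrix.of fun i j => 2 * L (r j) i).det := by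
    rw [← Matrix.det_submatrix_equiv_self (finSumFinEquiv : Fin 1 ⊕ Fin m ≃ Fin (1 + m)) D]
    have hconj : ∀ i j, D i j = Sum.elim (fun _ => star (covRow T L j p))
        (fun k => star (covRow T L j (r k)) + Complex.I * star (covRow T L j (r' k)))
        (finSumFinEquiv.symm i) := by
      intro i j
      have := hpair i ((Complex.conjLIE.toLinearEquiv.toLinearMap) ∘ₗ covLin T L j)
      simp only [LinearMap.comp_apply, covLin_apply] at this
      exact this
    have : D.submatrix finSumFinEquiv finSumFinEquiv = Matrix.fromBlocks 1 0
        ((D.submatrix finSumFinEquiv finSumFinEquiv).toBlocks₂₁)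
        (Matrix.of fun i j => 2 * L (r j) i) := by
      conv_lhs => rw [← Matrix.fromBlocks_toBlocks (D.submatrix finSumFinEquiv finSumFinEquiv)]
      congr 1
      · ext i j
        rw [Subsingleton.elim j i]
        simp [Matrix.toBlocks₁₁, hconj, covRow, h.T_p]
      · ext i j
        simp [Matrix.toBlocks₁₂, hconj, covRow, h.L_p]
      · ext i j
        have hh := congrFun (congrFun hpd.1 i) j
        simp only [Matrix.conjTranspose_apply, Matrix.of_apply] at hh
        simp only [Matrix.toBlocks₂₂, Matrix.submatrix_apply, Matrix.of_apply, hconj,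
          Equiv.symm_apply_apply, Sum.elim_inr, covRow, hL, ← hh]
        simp only [PiLp.smul_apply, smul_eq_mul, star_mul', Complex.star_def, Complex.conj_I]
        rw [← mul_assoc, mul_neg, Complex.I_mul_I]
        ring
    rw [this, Matrix.det_fromBlocks_zero₁₂, Matrix.det_one, one_mul]
  obtain ⟨d, hd, hdD⟩ : ∃ d : ℝ, 0 < d ∧ D.det = d := by
    have h1 : 0 < (Matrix.of fun i j => L (r j) i).det := hpd.det_pos
    have h2 : (Matrix.of fun i j => 2 * L (r j) i) =
        (2 : ℂ) • (Matrix.of fun i j => L (r j) i) := by ext; rfl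
    rw [hDdet, h2, Matrix.det_smul, Fintype.card_fin]
    obtain ⟨h3, h4⟩ := Complex.lt_def.1 h1
    refine ⟨2 ^ m * (Matrix.of fun i j => L (r j) i).det.re, mul_pos (by positivity) h3, ?_⟩
    push_cast
    congr 1
    exact Complex.ext rfl (by simpa using h4.symm)
  refine ⟨d, hd, fun σ => ?_⟩
  have hiso : covMatrix P L (fun i => e (finSumFinEquiv (σ (Sum.inl i)))) *
        Matrix.diagonal (fun i => (lorentzSign (finSumFinEquiv (σ (Sum.inl i))) : ℂ)) *
        (covMatrix P L (fun i => e (finSumFinEquiv (σ (Sum.inl i))))).transpose +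
      covMatrix P L (fun i => e (finSumFinEquiv (σ (Sum.inr i)))) *
        Matrix.diagonal (fun i => (lorentzSign (finSumFinEquiv (σ (Sum.inr i))) : ℂ)) *
        (covMatrix P L (fun i => e (finSumFinEquiv (σ (Sum.inr i))))).transpose = 0 := by
    ext i j
    rw [Matrix.add_apply, Matrix.mul_apply, Matrix.mul_apply]
    simp only [Matrix.mul_diagonal, Matrix.transpose_apply, covMatrix, Matrix.of_apply]
    have h1 := sum_inl_add_sum_inr σ
      (fun l => covRow P L i (e l) * (lorentzSign l : ℂ) * covRow P L j (e l))
    rw [h1]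
    have h2 := hpair i (covLin P L j)
    simp only [covLin_apply] at h2
    simp only [mul_comm (covRow P L i _)]
    rw [h2]
    obtain ⟨i, rfl⟩ := finSumFinEquiv.surjective i
    obtain ⟨j, rfl⟩ := finSumFinEquiv.surjective j
    rcases i with i | i <;> rcases j with j | j
    · simp [covRow, h.null]
    · simp [covRow, h.L_p]
    · simp [covRow, hPr, hPr']
    · simp [covRow, hL, ← mul_assoc]
  have hpairD : covMatrix P L (fun i => e (finSumFinEquiv (σ (Sum.inl i)))) *
        Matrix.diagonal (fun i => (lorentzSign (finSumFinEquiv (σ (Sum.inl i))) : ℂ)) *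
        ((covMatrix T L (fun i => e (finSumFinEquiv (σ (Sum.inl i))))).map star).transpose +
      covMatrix P L (fun i => e (finSumFinEquiv (σ (Sum.inr i)))) *
        Matrix.diagonal (fun i => (lorentzSign (finSumFinEquiv (σ (Sum.inr i))) : ℂ)) *
        ((covMatrix T L (fun i => e (finSumFinEquiv (σ (Sum.inr i))))).map star).transpose = D := by
    ext i j
    rw [Matrix.add_apply, Matrix.mul_apply, Matrix.mul_apply]
    simp only [Matrix.mul_diagonal, Matrix.transpose_apply, covMatrix, Matrix.of_apply,
      Matrix.map_apply]
    have h1 := sum_inl_add_sum_inr σ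
      (fun l => covRow P L i (e l) * (lorentzSign l : ℂ) * star (covRow T L j (e l)))
    rw [h1]
    simp only [mul_comm (covRow P L i _)]
    rfl
  refine ⟨?_, ?_⟩
  · rw [← hdD]
    exact Matrix.det_mul_det_of_isotropic _ _ _ _ D _ _ hiso hpairD
  · have h1 := Matrix.sq_det_of_isotropic _ _ _ _ D _ _ hiso hpairD
    have h2 : (∏ i, (lorentzSign (finSumFinEquiv (σ (Sum.inl i))) : ℂ)) *
        ∏ i, (lorentzSign (finSumFinEquiv (σ (Sum.inr i))) : ℂ) = -1 := by
      have h4 : ∏ j, (lorentzSign (finSumFinEquiv (σ j)) : ℂ) = ∏ l, (lorentzSign l : ℂ) :=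
        Fintype.prod_equiv (σ.trans finSumFinEquiv) _ _ fun _ => rfl
      rw [← Fintype.prod_sum_type fun j => (lorentzSign (finSumFinEquiv (σ j)) : ℂ), h4]
      exact_mod_cast congrArg (fun x : ℝ => (x : ℂ)) (prod_lorentzSign (n := (1 + m) + (1 + m))
        (by omega))
    rw [h2, Fintype.card_fin, hdD, pow_add] at h1
    have h3 : (nullMatrix P T L (fun j => e (finSumFinEquiv (σ j)))).det ^ 2 * -1 = _ := h1
    linear_combination -h3

end Transverse

/-! ### Orientation and the Hodge duals of the plane waves -/

section Volume

variable {V : Type*} [AddCommGroup V] [Module ℝ V] [TopologicalSpace V]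
  {m : ℕ} {g : V →L[ℝ] V →L[ℝ] ℝ} {p : V} {P T : V [⋀^Fin 1]→L[ℝ] ℝ}
  {L : V →L[ℝ] Cn m} {k : Cn m →L[ℝ] Cn m →L[ℝ] ℝ} {s : ℝ}

theorem smul_wedge {p q : ℕ} (c : ℝ) (a : V [⋀^Fin p]→L[ℝ] ℝ) (b : V [⋀^Fin q]→L[ℝ] ℝ) :
    wedge (c • a) b = c • wedge a b := by
  ext v
  rw [ContinuousAlternatingMap.smul_apply, wedge_apply, wedge_apply, smul_eq_mul, mul_left_comm c,
    Finset.mul_sum _ _ c]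
  congr 1
  refine Finset.sum_congr rfl fun σ _ => ?_
  rw [ContinuousAlternatingMap.smul_apply, smul_eq_mul]
  ring

/-- The real top-degree form `Re ((-i)ᵐ P ∧ α ∧ T ∧ conj α)`, expanded into the real and imaginary
parts of `α`. -/
def orientForm (P T : V [⋀^Fin 1]→L[ℝ] ℝ) (α : V [⋀^Fin m]→L[ℝ] ℂ) :
    V [⋀^Fin ((1 + m) + (1 + m))]→L[ℝ] ℝ :=
  wedge (wedge P (reForm ((-Complex.I) ^ m) α)) (wedge T (reForm 1 α)) -
    wedge (wedge P (reForm (-Complex.I * (-Complex.I) ^ m) α)) (wedge T (reForm Complex.I α))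

/-- Up to a factor, `orientForm` is the determinant of the null coframe `(P, L, T, conj L)`. -/
theorem orientForm_apply (Ω : Cn m [⋀^Fin m]→L[ℂ] ℂ) (v : Fin ((1 + m) + (1 + m)) → V) :
    orientForm P T (pullForm Ω L) v = Complex.normSq (topCoeff Ω) *
      ((-Complex.I) ^ m * (nullMatrix P T L fun j => v (finSumFinEquiv j)).det).re := by
  have h := sum_perm_det_mul_det (nullMatrix P T L fun j => v (finSumFinEquiv j))
  rw [Fintype.card_fin] at h
  have h2 := congrArg (fun z => Complex.normSq (topCoeff Ω) * ((-Complex.I) ^ m * z).re) h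
  rw [mul_left_comm, ← Complex.ofReal_natCast, Complex.re_ofReal_mul, mul_left_comm] at h2
  have hsub : ∀ (P T : V [⋀^Fin ((1 + m) + (1 + m))]→L[ℝ] ℝ), (P - T) v = P v - T v :=
    fun _ _ => rfl
  rw [orientForm, hsub, wedge_apply, wedge_apply, ← mul_sub, ← Finset.sum_sub_distrib,
    inv_mul_eq_iff_eq_mul₀ (by positivity), ← h2, Finset.mul_sum, Complex.re_sum, Finset.mul_sum]
  refine Finset.sum_congr rfl fun σ _ => ?_
  rw [← mul_sub, mul_left_comm ((-Complex.I) ^ m), ← Complex.ofReal_intCast,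
    Complex.re_ofReal_mul, mul_left_comm (Complex.normSq _)]
  congr 1
  have hB : (nullMatrix P T L fun j => v (finSumFinEquiv j)).submatrix Sum.inl
      (fun i => σ (Sum.inl i)) = covMatrix P L fun i => v (finSumFinEquiv (σ (Sum.inl i))) := by
    ext i j
    rw [Matrix.submatrix_apply]
    rcases hσ : σ (Sum.inl j) with x | x <;> simp [nullMatrix, covMatrix, hσ]
  have hC : (nullMatrix P T L fun j => v (finSumFinEquiv j)).submatrix Sum.inr
      (fun i => σ (Sum.inr i)) =
      (covMatrix T L fun i => v (finSumFinEquiv (σ (Sum.inr i)))).map star := by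
    ext i j
    rw [Matrix.submatrix_apply]
    rcases hσ : σ (Sum.inr j) with x | x <;> simp [nullMatrix, covMatrix, hσ]
  have hCd : ((covMatrix T L fun i => v (finSumFinEquiv (σ (Sum.inr i)))).map star).det =
      star (covMatrix T L fun i => v (finSumFinEquiv (σ (Sum.inr i)))).det := by
    rw [← Matrix.det_conjTranspose, Matrix.conjTranspose, Matrix.transpose_map,
      Matrix.det_transpose]
  rw [hB, hC, hCd]
  simp only [wedge_reForm_apply]
  generalize (covMatrix P L fun i => v (finSumFinEquiv (σ (Sum.inl i)))).det = b
  generalize (covMatrix T L fun i => v (finSumFinEquiv (σ (Sum.inr i)))).det = c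
  generalize (-Complex.I) ^ m = κ
  generalize topCoeff Ω = t
  simp only [Complex.mul_re, Complex.mul_im, Complex.star_def, Complex.conj_re, Complex.conj_im,
    Complex.normSq_apply, Complex.I_re, Complex.I_im, Complex.neg_re, Complex.neg_im,
    Complex.one_re, Complex.one_im]
  ring

/-- In an orthonormal basis the determinant of the null coframe is a positive multiple of `ε iᵐ` for
a sign `ε`. Hence `orientForm` has the sign `ε`, and the complementary minors of `(P, L)` are
proportional with a factor `ε iᵐ`. -/
theorem IsTransverselyHermitian.exists_sign (h : IsTransverselyHermitian g p P T L k s)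
    {e : Module.Basis (Fin ((1 + m) + (1 + m))) ℝ V} (he : IsLorentzBasis g e)
    {Ω : Cn m [⋀^Fin m]→L[ℂ] ℂ} (hΩ : Ω ≠ 0) :
    ∃ d ε : ℝ, 0 < d ∧ (ε = 1 ∨ ε = -1) ∧ orientForm P T (pullForm Ω L) e = d * ε ∧
      ∀ σ : Equiv.Perm (Fin (1 + m) ⊕ Fin (1 + m)),
      (covMatrix P L (fun i => e (finSumFinEquiv (σ (Sum.inl i))))).det =
        ((Equiv.Perm.sign σ : ℤ) : ℂ) * ε * Complex.I ^ m *
          ((∏ i, (lorentzSign (finSumFinEquiv (σ (Sum.inr i))) : ℂ)) *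
            (covMatrix P L (fun i => e (finSumFinEquiv (σ (Sum.inr i))))).det) := by
  obtain ⟨d, hd, H⟩ := h.exists_det he
  have h1 := (H (Equiv.refl _)).2
  simp only [Equiv.refl_apply] at h1
  set M₀ := (nullMatrix P T L fun j => e (finSumFinEquiv j)).det with hM₀
  have hd' : (d : ℂ) ≠ 0 := by exact_mod_cast hd.ne'
  have hI : (Complex.I ^ m) ^ 2 = (-1) ^ m := by rw [← pow_mul, mul_comm, pow_mul, Complex.I_sq]
  have hI' : (-Complex.I) ^ m * Complex.I ^ m = 1 := by
    rw [← mul_pow, neg_mul, Complex.I_mul_I]; simp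
  obtain ⟨ε, hε, hM⟩ : ∃ ε : ℝ, (ε = 1 ∨ ε = -1) ∧ M₀ = ε * (Complex.I ^ m * d) := by
    rw [← hI, ← mul_pow] at h1
    rcases sq_eq_sq_iff_eq_or_eq_neg.1 h1 with h2 | h2
    · exact ⟨1, Or.inl rfl, by simpa using h2⟩
    · exact ⟨-1, Or.inr rfl, by simpa using h2⟩
  refine ⟨Complex.normSq (topCoeff Ω) * d, ε,
    mul_pos (Complex.normSq_pos.2 (topCoeff_ne_zero hΩ)) hd, hε, ?_, fun σ => ?_⟩
  · rw [orientForm_apply, ← hM₀, hM, mul_left_comm, ← mul_assoc ((-Complex.I) ^ m), hI', one_mul,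
      ← Complex.ofReal_mul, Complex.ofReal_re]
    ring
  · have h3 := (H σ).1
    have h4 : (nullMatrix P T L fun j => e (finSumFinEquiv (σ j))).det =
        ((Equiv.Perm.sign σ : ℤ) : ℂ) * M₀ := by
      rw [hM₀, ← Matrix.det_permute']
      congr 1
      ext i j
      rw [Matrix.submatrix_apply, id]
      rcases hσ : σ j with x | x <;> rcases i with i | i <;> rcases j with j | j <;>
        simp [nullMatrix, covMatrix, hσ]
    rw [h4, hM] at h3
    apply mul_right_cancel₀ hd'
    rw [h3]
    ring

/-- The Hodge operator on the forms `q ∧ Re (c α)`, where `α` is the pull-back of a complex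
volume form and `q` is a multiple of `P`. -/
theorem IsTransverselyHermitian.isHodgeDual (h : IsTransverselyHermitian g p P T L k s)
    {Ω : Cn m [⋀^Fin m]→L[ℂ] ℂ} (hΩ : Ω ≠ 0) {vol : V [⋀^Fin ((1 + m) + (1 + m))]→L[ℝ] ℝ} {r : ℝ}
    (hr : 0 < r) (hvol : vol = r • orientForm P T (pullForm Ω L))
    (hunit : ∀ e : Module.Basis (Fin ((1 + m) + (1 + m))) ℝ V, IsLorentzBasis g e → |vol e| = 1)
    (f : ℝ) (c : ℂ) :
    IsHodgeDual g vol (wedge (f • P) (reForm c (pullForm Ω L)))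
      (wedge (f • P) (reForm (-Complex.I ^ m * c) (pullForm Ω L))) := by
  intro e he a
  obtain ⟨d, ε, hd, hε, hval, hdet⟩ := h.exists_sign he hΩ
  have hve : vol e = ε := by
    have h1 : vol e = r * d * ε := by
      rw [hvol, ContinuousAlternatingMap.smul_apply, hval, smul_eq_mul, mul_assoc]
    have h2 := hunit e he
    have h3 : |ε| = 1 := by rcases hε with rfl | rfl <;> simp
    rw [h1, abs_mul, h3, mul_one, abs_of_pos (mul_pos hr hd)] at h2
    rw [h1, h2, one_mul]
  refine wedge_eq_formInner_smul e vol _ _ (fun σ => ?_) a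
  rw [smul_wedge, smul_wedge, ContinuousAlternatingMap.smul_apply,
    ContinuousAlternatingMap.smul_apply, wedge_reForm_apply, wedge_reForm_apply, hve, hdet σ]
  have hprod : (∏ i, lorentzSign (finSumFinEquiv (σ (Sum.inl i)))) *
      ∏ i, lorentzSign (finSumFinEquiv (σ (Sum.inr i))) = -1 := by
    have h4 : ∏ j, lorentzSign (finSumFinEquiv (σ j)) = ∏ l, lorentzSign l :=
      Fintype.prod_equiv (σ.trans finSumFinEquiv) _ _ fun _ => rfl
    rw [← Fintype.prod_sum_type fun j => lorentzSign (finSumFinEquiv (σ j)), h4,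
      prod_lorentzSign (by omega)]
  have hεε : ε * ε = 1 := by rcases hε with rfl | rfl <;> norm_num
  rw [← Complex.ofReal_prod]
  generalize (covMatrix P L fun i => e (finSumFinEquiv (σ (Sum.inr i)))).det = b
  set A := ∏ i, lorentzSign (finSumFinEquiv (σ (Sum.inl i)))
  set B := ∏ i, lorentzSign (finSumFinEquiv (σ (Sum.inr i)))
  have h5 : c * topCoeff Ω * (((Equiv.Perm.sign σ : ℤ) : ℂ) * ε * Complex.I ^ m * ((B : ℂ) * b)) =
      (((Equiv.Perm.sign σ : ℤ) : ℝ) * ε * B : ℝ) * (c * topCoeff Ω * Complex.I ^ m * b) := by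
    push_cast; ring
  have h6 : -Complex.I ^ m * c * topCoeff Ω * b =
      -(c * topCoeff Ω * Complex.I ^ m * b) := by ring
  rw [h5, Complex.re_ofReal_mul, h6, Complex.neg_re, smul_eq_mul, smul_eq_mul]
  linear_combination (-((Equiv.Perm.sign σ : ℤ) : ℝ) * f *
    (c * topCoeff Ω * Complex.I ^ m * b).re) * (hprod * (ε * ε) - hεε)

end Volume

/-! ### Exterior derivatives in vector spaces -/

section Calculus

open ContinuousAlternatingMap

/-- Smoothness of a form can be checked by evaluating it on constant vectors. -/
theorem contDiffWithinAt_alternating {E X F : Type*} [NormedAddCommGroup E] [NormedSpace ℝ E]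
    [FiniteDimensional ℝ E] [NormedAddCommGroup X] [NormedSpace ℝ X] [NormedAddCommGroup F]
    [NormedSpace ℝ F] [FiniteDimensional ℝ F] {n : ℕ} {r : WithTop ℕ∞}
    {a : X → E [⋀^Fin n]→L[ℝ] F} {s : Set X} {x : X}
    (h : ∀ v, ContDiffWithinAt ℝ r (fun y => a y v) s x) : ContDiffWithinAt ℝ r a s x := by
  let b := Module.finBasis ℝ E
  let ev : (E [⋀^Fin n]→L[ℝ] F) →ₗ[ℝ] ((Fin n → Fin (Module.finrank ℝ E)) → F) :=
    { toFun := fun a i => a fun j => b (i j)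
      map_add' := fun _ _ => rfl
      map_smul' := fun _ _ => rfl }
  have hinj : LinearMap.ker ev = ⊥ := by
    refine LinearMap.ker_eq_bot'.2 fun a ha => ?_
    apply ContinuousAlternatingMap.toAlternatingMap_injective
    exact b.ext_alternating fun i _ => congrFun ha i
  obtain ⟨l, hl⟩ := ev.exists_leftInverse_of_injective hinj
  have h1 : ContDiffWithinAt ℝ r (fun y => ev (a y)) s x :=
    contDiffWithinAt_pi.2 fun i => h _
  have h2 := (LinearMap.toContinuousLinearMap l).contDiff.comp_contDiffWithinAt h1
  have h3 : (LinearMap.toContinuousLinearMap l) ∘ (fun y => ev (a y)) = a := by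
    funext y
    exact congrArg (fun f => f (a y)) hl
  rwa [h3] at h2

variable {E : Type*} [NormedAddCommGroup E] [NormedSpace ℝ E]

theorem contDiffWithinAt_wedge [FiniteDimensional ℝ E] {X : Type*} [NormedAddCommGroup X]
    [NormedSpace ℝ X] {p q : ℕ} {r : WithTop ℕ∞} {a : X → E [⋀^Fin p]→L[ℝ] ℝ}
    {b : X → E [⋀^Fin q]→L[ℝ] ℝ} {s : Set X} {x : X} (ha : ContDiffWithinAt ℝ r a s x)
    (hb : ContDiffWithinAt ℝ r b s x) : ContDiffWithinAt ℝ r (fun y => wedge (a y) (b y)) s x := by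
  refine contDiffWithinAt_alternating fun v => ?_
  simp only [wedge_apply]
  refine contDiffWithinAt_const.mul (ContDiffWithinAt.sum fun σ _ => contDiffWithinAt_const.mul
    (ContDiffWithinAt.mul ?_ ?_))
  · exact (ContinuousAlternatingMap.apply ℝ E ℝ _).contDiff.comp_contDiffWithinAt ha
  · exact (ContinuousAlternatingMap.apply ℝ E ℝ _).contDiff.comp_contDiffWithinAt hb

/-- Complex forms of degree `m + 1` on `ℂᵐ` vanish. -/
theorem alternating_succ_eq_zero {m : ℕ} (a : Cn m [⋀^Fin (m + 1)]→L[ℂ] ℂ) : a = 0 := by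
  ext v
  refine a.toAlternatingMap.map_linearDependent v fun h => ?_
  have := h.fintype_card_le_finrank
  simp at this

/-- A holomorphic form of top degree is closed, because its complex exterior derivative is a complex
form of degree `m + 1` on `ℂᵐ`. -/
theorem extDeriv_restrictScalars_eq_zero {m : ℕ} {a : Cn m → Cn m [⋀^Fin m]→L[ℂ] ℂ} {z : Cn m}
    (ha : DifferentiableAt ℂ a z) :
    extDeriv (fun z => (a z).restrictScalars ℝ) z = 0 := by
  have ha' : DifferentiableAt ℝ (fun z => (a z).restrictScalars ℝ) z :=
    (restrictScalarsCLM (𝕜 := ℂ) (E := Cn m) (F := ℂ) (ι := Fin m) ℝ).differentiableAt.comp z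
      (ha.restrictScalars ℝ)
  ext v
  have h := congrArg (fun f => f v) (alternating_succ_eq_zero (extDeriv a z))
  simp only [extDeriv_apply ha] at h
  rw [extDeriv_apply ha']
  rw [← show _ = (0 : Cn m [⋀^Fin (m + 1)]→L[ℝ] ℂ) v from h]
  refine Finset.sum_congr rfl fun i _ => ?_
  congr 1
  have h1 : DifferentiableAt ℂ (fun z => a z (i.removeNth v)) z :=
    (ContinuousAlternatingMap.apply ℂ (Cn m) ℂ (i.removeNth v)).differentiableAt.comp z ha
  exact congrArg (fun f => f (v i)) (h1.fderiv_restrictScalars ℝ)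

/-- `b ∧ Ω = 0` for a complex linear form `b` and a complex volume form `Ω`, and this is preserved
by pull-backs. -/
theorem alternatizeUncurryFin_smulRight_pullForm {m : ℕ} (Ω : Cn m [⋀^Fin m]→L[ℂ] ℂ)
    (L : E →L[ℝ] Cn m) (b : Cn m →L[ℂ] ℂ) :
    alternatizeUncurryFin (((b.restrictScalars ℝ) ∘L L).smulRight (pullForm Ω L)) = 0 := by
  ext v
  have h := congrArg (fun f => f fun i => L (v i))
    (alternating_succ_eq_zero (alternatizeUncurryFin (b.smulRight Ω)))
  simp only [alternatizeUncurryFin_apply] at h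
  rw [alternatizeUncurryFin_apply]
  exact h

/-- The continuous linear functional underlying a `1`-form. -/
def oneFormCLM : (E [⋀^Fin 1]→L[ℝ] ℝ) →L[ℝ] E →L[ℝ] ℝ :=
  (ofSubsingletonLIE (𝕜 := ℝ) (E := E) (F := ℝ)
    (0 : Fin 1)).symm.toContinuousLinearEquiv.toContinuousLinearMap

theorem oneFormCLM_apply (q : E [⋀^Fin 1]→L[ℝ] ℝ) (v : E) : oneFormCLM q v = q ![v] := by
  obtain ⟨f, rfl⟩ := (ofSubsingletonLIE (𝕜 := ℝ) (E := E) (F := ℝ) (0 : Fin 1)).surjective q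
  change ((ofSubsingletonLIE (𝕜 := ℝ) (E := E) (F := ℝ) (0 : Fin 1)).symm _) v = f (![v] 0)
  rw [LinearIsometryEquiv.symm_apply_apply]
  rfl

/-- The exterior product of a real covector with a complex-valued form. -/
def covWedge (n : ℕ) : (E →L[ℝ] ℝ) →L[ℝ] (E [⋀^Fin n]→L[ℝ] ℂ) →L[ℝ] E [⋀^Fin (n + 1)]→L[ℝ] ℂ :=
  (ContinuousLinearMap.compL ℝ _ _ _ (alternatizeUncurryFinCLM ℝ E ℂ)) ∘L
    (ContinuousLinearMap.smulRightL ℝ E (E [⋀^Fin n]→L[ℝ] ℂ))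

theorem covWedge_apply {n : ℕ} (q : E →L[ℝ] ℝ) (α : E [⋀^Fin n]→L[ℝ] ℂ) :
    covWedge n q α = alternatizeUncurryFin (q.smulRight α) := rfl

/-- The exterior product of a complex-valued covector with a complex-valued form. -/
def covWedgeC {n : ℕ} (q : E →L[ℝ] ℂ) (α : E [⋀^Fin n]→L[ℝ] ℂ) : E [⋀^Fin (n + 1)]→L[ℝ] ℂ :=
  alternatizeUncurryFin (((1 : ℂ →L[ℝ] ℂ).smulRight α) ∘L q)

set_option maxSynthPendingDepth 3 in
/-- `d(q ∧ α) = 0` if `dα = 0` and `dq` is the antisymmetrisation of a bilinear form `B` such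
that `B(u, ·) ∧ α = 0`. Up to terms that are symmetric in `u` and `v` and so do not contribute,
the derivative of `q ∧ α` is the alternatization of `B(u, v) α - q(u) D_v α`. -/
theorem extDeriv_covWedge_eq_zero {n : ℕ} {q : E → E →L[ℝ] ℝ} {α : E → E [⋀^Fin n]→L[ℝ] ℂ} {y : E}
    (hq : DifferentiableAt ℝ q y) (hα : DifferentiableAt ℝ α y) (hdα : extDeriv α y = 0)
    (B : E →L[ℝ] E →L[ℝ] ℂ)
    (hB : ∀ u v, ((fderiv ℝ q y u v - fderiv ℝ q y v u : ℝ) : ℂ) = B u v - B v u)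
    (hBα : ∀ u, covWedgeC (B u) (α y) = 0) :
    extDeriv (fun z => covWedge n (q z) (α z)) y = 0 := by
  have h1 := (ContinuousLinearMap.hasFDerivAt_of_bilinear (covWedge n) hq.hasFDerivAt
    hα.hasFDerivAt).fderiv
  -- `Φ` is the derivative before alternatization, and `Φ - Ψ` is symmetric
  let Φ : E →L[ℝ] E →L[ℝ] E [⋀^Fin n]→L[ℝ] ℂ :=
    (ContinuousLinearMap.smulRightL ℝ E (E [⋀^Fin n]→L[ℝ] ℂ)).precompR E (q y) (fderiv ℝ α y) +
    (ContinuousLinearMap.smulRightL ℝ E (E [⋀^Fin n]→L[ℝ] ℂ)).precompL E (fderiv ℝ q y) (α y)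
  have hΦ : ∀ u v, Φ u v = q y v • fderiv ℝ α y u + fderiv ℝ q y u v • α y := fun u v => rfl
  let Ψ : E →L[ℝ] E →L[ℝ] E [⋀^Fin n]→L[ℝ] ℂ :=
    (ContinuousLinearMap.compL ℝ E ℂ _ ((1 : ℂ →L[ℝ] ℂ).smulRight (α y))) ∘L B -
      (q y).smulRight (fderiv ℝ α y)
  have hΨ : ∀ u, Ψ u = ((1 : ℂ →L[ℝ] ℂ).smulRight (α y)) ∘L B u - q y u • fderiv ℝ α y :=
    fun u => rfl
  have h2 : fderiv ℝ (fun z => covWedge n (q z) (α z)) y = alternatizeUncurryFinCLM ℝ E ℂ ∘L Φ := by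
    rw [h1]
    ext1 u
    change alternatizeUncurryFinCLM ℝ E ℂ _ + alternatizeUncurryFinCLM ℝ E ℂ _ =
      alternatizeUncurryFinCLM ℝ E ℂ (_ + _)
    rw [map_add]
    rfl
  have h3 : alternatizeUncurryFinCLM ℝ E ℂ ∘L Ψ = 0 := by
    ext1 u
    change alternatizeUncurryFinCLM ℝ E ℂ (Ψ u) = 0
    rw [hΨ, map_sub, map_smul]
    change covWedgeC (B u) (α y) - q y u • extDeriv α y = 0
    rw [hBα, hdα, smul_zero, sub_zero]
  let Θ : E →L[ℝ] E →L[ℝ] E [⋀^Fin n]→L[ℝ] ℂ := Φ - Ψ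
  have h4 : alternatizeUncurryFin (alternatizeUncurryFinCLM ℝ E ℂ ∘L Θ) = 0 := by
    refine alternatizeUncurryFin_alternatizeUncurryFinCLM_comp_of_symmetric fun u v => ?_
    have h5 := hB u v
    change Φ u v - Ψ u v = Φ v u - Ψ v u
    rw [hΦ, hΦ, hΨ, hΨ]
    ext w
    change ((q y v • fderiv ℝ α y u w + fderiv ℝ q y u v • α y w) -
        (B u v * α y w - q y u • fderiv ℝ α y v w) : ℂ) =
      (q y u • fderiv ℝ α y v w + fderiv ℝ q y v u • α y w) -
        (B v u * α y w - q y v • fderiv ℝ α y u w)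
    simp only [Complex.real_smul]
    push_cast at h5
    linear_combination (α y w) * h5
  rw [extDeriv, h2]
  have h6 : alternatizeUncurryFinCLM ℝ E ℂ ∘L Φ = alternatizeUncurryFinCLM ℝ E ℂ ∘L Θ := by
    rw [← add_zero (alternatizeUncurryFinCLM ℝ E ℂ ∘L Θ), ← h3, ← ContinuousLinearMap.comp_add]
    congr 1
    exact (sub_add_cancel Φ Ψ).symm
  rw [h6, h4]

/-- The real part of a multiple of a closed complex form is closed. The equation `n = l + 1` allows
for degrees that are not of this form definitionally. -/
theorem extDeriv_reForm_eq_zero {n l : ℕ} (h : n = l + 1) (c : ℂ) {a : E → E [⋀^Fin n]→L[ℝ] ℝ}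
    {b : E → E [⋀^Fin (l + 1)]→L[ℝ] ℂ} {y : E} (hb : DifferentiableAt ℝ b y)
    (hab : ∀ᶠ z in 𝓝 y, ∀ v, a z v = (c * b z fun i => v (Fin.cast h.symm i)).re)
    (hd : extDeriv b y = 0) : extDeriv a y = 0 := by
  subst h
  have h1 : a =ᶠ[𝓝 y] fun z => reForm c (b z) := by
    filter_upwards [hab] with z hz
    ext v
    exact hz v
  rw [h1.extDeriv_eq]
  let l' : ℂ →L[ℝ] ℝ := Complex.reCLM ∘L (c • ContinuousLinearMap.id ℝ ℂ)
  have hev : ∀ w, DifferentiableAt ℝ (fun z => b z w) y := fun w =>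
    (ContinuousAlternatingMap.apply ℝ E ℂ w).differentiableAt.comp y hb
  have h2 : DifferentiableAt ℝ (fun z => reForm c (b z)) y :=
    (ContinuousLinearMap.compContinuousAlternatingMapCLM ℝ E ℂ ℝ (Fin (l + 1))
      l').differentiableAt.comp y hb
  ext v
  rw [extDeriv_apply h2]
  have h3 : ∀ w, fderiv ℝ (fun z => reForm c (b z) w) y = l' ∘L fderiv ℝ (fun z => b z w) y :=
    fun w => (l'.hasFDerivAt.comp y (hev w).hasFDerivAt).fderiv
  have h4 := congrArg (fun f => l' (f v)) hd
  simp only [extDeriv_apply hb, _root_.map_sum, map_zsmul] at h4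
  simp only [h3]
  exact h4.trans (map_zero l')

/-- The form `q ∧ Re (c α)` of degree `1 + m`, defined by shuffles, is the real part of the form
`c q ∧ α` of degree `m + 1` that is defined by alternatization. -/
theorem wedge_reForm_eq_covWedge {m : ℕ} (q : E [⋀^Fin 1]→L[ℝ] ℝ) (L : E →L[ℝ] Cn m)
    (Ω : Cn m [⋀^Fin m]→L[ℂ] ℂ) (c : ℂ) (v : Fin (1 + m) → E) :
    wedge q (reForm c (pullForm Ω L)) v = (c * covWedge m (oneFormCLM q) (pullForm Ω L)
      fun i => v (Fin.cast (add_comm m 1) i)).re := by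
  rw [wedge_reForm_apply, mul_assoc]
  congr 2
  rw [covWedge_apply, alternatizeUncurryFin_apply,
    ← Matrix.det_submatrix_equiv_self (finCongr (add_comm m 1)), Matrix.det_succ_row_zero,
    Finset.mul_sum]
  have h0 : finSumFinEquiv.symm (finCongr (add_comm m 1) 0) = Sum.inl (0 : Fin 1) := by
    rw [Equiv.symm_apply_eq]; rfl
  have hs : ∀ i : Fin m, finSumFinEquiv.symm (finCongr (add_comm m 1) i.succ) =
      (Sum.inr i : Fin 1 ⊕ Fin m) := fun i => by
    rw [Equiv.symm_apply_eq]
    ext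
    simp [add_comm]
  refine Finset.sum_congr rfl fun i _ => ?_
  change _ = (-1 : ℤ) ^ (i : ℕ) • ((oneFormCLM q _ : ℝ) • Ω _)
  rw [apply_eq_topCoeff_mul_det, oneFormCLM_apply]
  have h1 : ((covMatrix q L v).submatrix (finCongr (add_comm m 1)) (finCongr (add_comm m 1))) 0 i =
      ((q ![v (Fin.cast (add_comm m 1) i)] : ℝ) : ℂ) := by
    simp only [Matrix.submatrix_apply, covMatrix, covRow, Matrix.of_apply, h0, Sum.elim_inl]
    rfl
  have h2 : ((covMatrix q L v).submatrix (finCongr (add_comm m 1))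
      (finCongr (add_comm m 1))).submatrix Fin.succ i.succAbove =
      Matrix.of fun k j => L (i.removeNth (fun i => v (Fin.cast (add_comm m 1) i)) j) k := by
    ext k j
    simp only [Matrix.submatrix_apply, covMatrix, covRow, Matrix.of_apply, hs, Sum.elim_inr]
    rfl
  rw [h1, h2, zsmul_eq_mul, Complex.real_smul]
  push_cast
  ring

end Calculus

/-! ### Pull-backs of holomorphic forms in charts -/

section Charts

variable {𝕜 : Type*} [NontriviallyNormedField 𝕜]
  {E : Type*} [NormedAddCommGroup E] [NormedSpace 𝕜 E] {H : Type*} [TopologicalSpace H]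
  {I : ModelWithCorners 𝕜 E H} {M : Type*} [TopologicalSpace M] [ChartedSpace H M]

theorem mdifferentiableAt_extChartAt_symm [I.Boundaryless] [IsManifold I 1 M] {x : M} {y : E}
    (hy : y ∈ (extChartAt I x).target) :
    MDifferentiableAt 𝓘(𝕜, E) I (extChartAt I x).symm y := by
  have h := mdifferentiableWithinAt_extChartAt_symm hy
  rwa [I.range_eq_univ, mdifferentiableWithinAt_univ] at h

theorem isInvertible_mfderiv_extChartAt_symm [I.Boundaryless] [IsManifold I 1 M] {x : M} {y : E}
    (hy : y ∈ (extChartAt I x).target) :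
    (mfderiv 𝓘(𝕜, E) I (extChartAt I x).symm y).IsInvertible := by
  have h := isInvertible_mfderivWithin_extChartAt_symm hy
  rwa [I.range_eq_univ, mfderivWithin_univ] at h

end Charts

section ComplexCharts

variable {m : ℕ} {N : Type*} [TopologicalSpace N] [ChartedSpace (Cn m) N]

theorem HasMFDerivAt.restrictScalars_real {f : Cn m → N} {z : Cn m}
    {f' : Cn m →L[ℂ] Cn m} (h : HasMFDerivAt 𝓘(ℂ, Cn m) 𝓘(ℂ, Cn m) f z f') :
    HasMFDerivAt 𝓘(ℝ, Cn m) 𝓘(ℝ, Cn m) f z (f'.restrictScalars ℝ) :=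
  ⟨h.1, HasFDerivWithinAt.restrictScalars ℝ h.2⟩

variable {E : Type*} [NormedAddCommGroup E] [NormedSpace ℝ E] {H : Type*} [TopologicalSpace H]
  {I : ModelWithCorners ℝ E H} {M : Type*} [TopologicalSpace M] [ChartedSpace H M]

/-- The pull-back of a complex `(n, 0)`-form by a map from a real manifold. -/
def pullField {n : ℕ} (I : ModelWithCorners ℝ E H) (Ω : DiffForm 𝓘(ℂ, Cn m) N ℂ n) (P : M → N) :
    DiffForm I M ℂ n :=
  fun x => pullForm (Ω (P x)) (mfderiv I 𝓘(ℝ, Cn m) P x)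

variable (m) in
/-- A map into a complex manifold, read in the preferred charts. -/
def mapInChart (I : ModelWithCorners ℝ E H) (P : M → N) (x₀ : M) (z₁ : N) (y : E) : Cn m :=
  extChartAt 𝓘(ℂ, Cn m) z₁ (P ((extChartAt I x₀).symm y))

variable [I.Boundaryless] [IsManifold I ∞ M] {P : M → N}

theorem contDiffAt_mapInChart (hP : ContMDiff I 𝓘(ℝ, Cn m) ∞ P) {x₀ : M} {y : E}
    (hy : y ∈ (extChartAt I x₀).target) :
    ContDiffAt ℝ ∞ (mapInChart m I P x₀ (P ((extChartAt I x₀).symm y))) y := by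
  have h1 : ContMDiffAt 𝓘(ℝ, E) I ∞ (extChartAt I x₀).symm y :=
    (contMDiffOn_extChartAt_symm x₀).contMDiffAt
      ((isOpen_extChartAt_target x₀).mem_nhds hy)
  have h2 : ContMDiffAt 𝓘(ℝ, E) 𝓘(ℝ, Cn m) ∞ (P ∘ (extChartAt I x₀).symm) y :=
    (hP _).comp y h1
  have h3 := (contMDiffAt_iff.1 h2).2
  simp only [modelWithCornersSelf_coe, Set.range_id, contDiffWithinAt_univ] at h3
  exact h3

/-- In charts the pull-back of a complex form is the pull-back of its local representation. -/
theorem formInChart_pullField_eventuallyEq [IsManifold 𝓘(ℂ, Cn m) ω N] {n : ℕ}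
    (Ω : DiffForm 𝓘(ℂ, Cn m) N ℂ n)
    (hP : ContMDiff I 𝓘(ℝ, Cn m) ∞ P) {x₀ : M} {y₁ : E} (hy₁ : y₁ ∈ (extChartAt I x₀).target) :
    formInChart (pullField I Ω P) x₀ =ᶠ[𝓝 y₁] fun y =>
      pullForm (formInChart Ω (P ((extChartAt I x₀).symm y₁))
          (mapInChart m I P x₀ (P ((extChartAt I x₀).symm y₁)) y))
        (fderiv ℝ (mapInChart m I P x₀ (P ((extChartAt I x₀).symm y₁))) y) := by
  have : IsManifold 𝓘(ℂ, Cn m) 1 N := IsManifold.of_le (n := ω) le_top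
  have : IsManifold I 1 M := IsManifold.of_le (n := ∞) (by simp)
  set z₁ := P ((extChartAt I x₀).symm y₁) with hz₁
  set Q := mapInChart m I P x₀ z₁ with hQ
  have hcont : ContinuousAt (P ∘ (extChartAt I x₀).symm) y₁ :=
    hP.continuous.continuousAt.comp (continuousAt_extChartAt_symm'' hy₁)
  have hnear : ∀ᶠ y in 𝓝 y₁, y ∈ (extChartAt I x₀).target ∧
      P ((extChartAt I x₀).symm y) ∈ (extChartAt 𝓘(ℂ, Cn m) z₁).source ∧
      DifferentiableAt ℝ Q y := by
    refine (Filter.Eventually.and ((isOpen_extChartAt_target x₀).mem_nhds hy₁)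
      ((hcont.eventually (extChartAt_source_mem_nhds z₁)).and ?_))
    have h1 : ContDiffAt ℝ 1 Q y₁ := (contDiffAt_mapInChart hP hy₁).of_le (by simp)
    filter_upwards [h1.eventually (by simp)] with y hy
    exact hy.differentiableAt one_ne_zero
  filter_upwards [eventually_eventually_nhds.2 hnear] with y hy
  obtain ⟨hyt, hys, hyd⟩ := hy.self_of_nhds
  have hinv : ∀ {y}, P ((extChartAt I x₀).symm y) ∈ (extChartAt 𝓘(ℂ, Cn m) z₁).source →
      (extChartAt 𝓘(ℂ, Cn m) z₁).symm (Q y) = P ((extChartAt I x₀).symm y) :=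
    fun h => (extChartAt 𝓘(ℂ, Cn m) z₁).left_inv h
  have hQt : Q y ∈ (extChartAt 𝓘(ℂ, Cn m) z₁).target :=
    (extChartAt 𝓘(ℂ, Cn m) z₁).map_source hys
  -- the two sides are the derivatives of `P` composed with the chart, computed in two ways
  have h1 : HasMFDerivAt 𝓘(ℝ, E) 𝓘(ℝ, Cn m) (P ∘ (extChartAt I x₀).symm) y
      ((mfderiv I 𝓘(ℝ, Cn m) P ((extChartAt I x₀).symm y)) ∘L
        (mfderiv 𝓘(ℝ, E) I (extChartAt I x₀).symm y)) :=
    ((hP.mdifferentiable (by simp) _).hasMFDerivAt).comp y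
      (mdifferentiableAt_extChartAt_symm hyt).hasMFDerivAt
  have h2 : HasMFDerivAt 𝓘(ℝ, E) 𝓘(ℝ, Cn m) ((extChartAt 𝓘(ℂ, Cn m) z₁).symm ∘ Q) y
      (((mfderiv 𝓘(ℂ, Cn m) 𝓘(ℂ, Cn m) (extChartAt 𝓘(ℂ, Cn m) z₁).symm (Q y)).restrictScalars ℝ)
        ∘L (fderiv ℝ Q y)) :=
    (HasMFDerivAt.restrictScalars_real
      (mdifferentiableAt_extChartAt_symm hQt).hasMFDerivAt).comp y hyd.hasFDerivAt.hasMFDerivAt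
  have h3 : P ∘ (extChartAt I x₀).symm =ᶠ[𝓝 y] (extChartAt 𝓘(ℂ, Cn m) z₁).symm ∘ Q := by
    filter_upwards [hy] with y' hy'
    exact (hinv hy'.2.1).symm
  have h4 := hasMFDerivAt_unique h1 (h2.congr_of_eventuallyEq h3)
  ext v
  have h5 : ∀ z, z = P ((extChartAt I x₀).symm y) → ∀ w : Fin n → Cn m,
    Ω z w = Ω (P ((extChartAt I x₀).symm y)) w := by
    rintro _ rfl w; rfl
  refine Eq.trans ?_ (h5 _ (hinv hys) _).symm
  have h6 : ∀ u : E, (mfderiv I 𝓘(ℝ, Cn m) P ((extChartAt I x₀).symm y))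
      (mfderiv 𝓘(ℝ, E) I (extChartAt I x₀).symm y u) =
      (mfderiv 𝓘(ℂ, Cn m) 𝓘(ℂ, Cn m) (extChartAt 𝓘(ℂ, Cn m) z₁).symm (Q y)) (fderiv ℝ Q y u) :=
    fun u => congrArg (fun f => f u) h4
  exact congrArg (Ω (P ((extChartAt I x₀).symm y))) (funext fun i => h6 (v i))

end ComplexCharts

/-! ### Smoothness and closedness of the plane waves -/

section FormsInCharts

theorem IsSmoothForm.contDiffAt {𝕜 : Type*} [NontriviallyNormedField 𝕜]
    {E : Type*} [NormedAddCommGroup E] [NormedSpace 𝕜 E] {H : Type*} [TopologicalSpace H]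
    {I : ModelWithCorners 𝕜 E H} [I.Boundaryless] {M : Type*} [TopologicalSpace M]
    [ChartedSpace H M] {F : Type*} [NormedAddCommGroup F] [NormedSpace 𝕜 F] {p : ℕ}
    {a : DiffForm I M F p} (ha : IsSmoothForm a) {x : M} {y : E}
    (hy : y ∈ (extChartAt I x).target) : ContDiffAt 𝕜 ∞ (formInChart a x) y :=
  (ha x).contDiffAt ((isOpen_extChartAt_target x).mem_nhds hy)

variable {E : Type*} [NormedAddCommGroup E] [NormedSpace ℝ E] {H : Type*} [TopologicalSpace H]
  {I : ModelWithCorners ℝ E H} {M : Type*} [TopologicalSpace M] [ChartedSpace H M]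

theorem formInChart_wedge {p q : ℕ} (a : DiffForm I M ℝ p) (b : DiffForm I M ℝ q) (x₀ : M) :
    formInChart (fun x => wedge (a x) (b x)) x₀ =
      fun y => wedge (V := E) (formInChart a x₀ y) (formInChart b x₀ y) := by
  funext y
  ext v
  rw [wedge_apply]
  exact wedge_apply _ _ _

theorem IsSmoothForm.wedge [FiniteDimensional ℝ E] {p q : ℕ} {a : DiffForm I M ℝ p}
    {b : DiffForm I M ℝ q} (ha : IsSmoothForm a) (hb : IsSmoothForm b) :
    IsSmoothForm fun x => wedge (a x) (b x) := by
  intro x₀ y hy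
  rw [formInChart_wedge]
  exact contDiffWithinAt_wedge (ha x₀ y hy) (hb x₀ y hy)

theorem IsSmoothForm.reForm {p : ℕ} {a : DiffForm I M ℂ p} (ha : IsSmoothForm a) (c : ℂ) :
    IsSmoothForm fun x => reForm c (a x) := by
  intro x₀ y hy
  exact (ContinuousLinearMap.compContinuousAlternatingMapCLM ℝ E ℂ ℝ (Fin p)
    (Complex.reCLM ∘L (c • ContinuousLinearMap.id ℝ ℂ))).contDiff.comp_contDiffWithinAt (ha x₀ y hy)

theorem IsSmoothForm.sub {p : ℕ} {a b : DiffForm I M ℝ p} (ha : IsSmoothForm a)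
    (hb : IsSmoothForm b) : IsSmoothForm fun x => a x - b x := by
  intro x₀ y hy
  exact (ha x₀ y hy).sub (hb x₀ y hy)

theorem mfderiv_extChartAt_symm_self [I.Boundaryless] [IsManifold I 1 M] (x : M) :
    mfderiv 𝓘(ℝ, E) I (extChartAt I x).symm (extChartAt I x x) = ContinuousLinearMap.id ℝ E := by
  have h := mfderiv_extChartAt_comp_mfderivWithin_extChartAt_symm' (I := I)
    (mem_extChartAt_source (I := I) x)
  rw [mfderiv_extChartAt_self, I.range_eq_univ, mfderivWithin_univ] at h
  ext1 v
  exact congrArg (fun f => f v) h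

/-- The chart of `x` identifies the exterior derivative at `x` with that of the local
representation. -/
theorem extD_eq [IsManifold I 1 M] {p : ℕ} (a : DiffForm I M ℝ p) (x : M) :
    extD a x = extDeriv (formInChart a x) (extChartAt I x x) := by
  rw [extD, mfderiv_extChartAt_self]
  rfl

variable {m : ℕ} {N : Type*} [TopologicalSpace N] [ChartedSpace (Cn m) N]
  [IsManifold 𝓘(ℂ, Cn m) ω N] [I.Boundaryless] [IsManifold I ∞ M] {P : M → N}

/-- The pull-back of a holomorphic form of top degree is smooth: in charts it is the product of a
holomorphic function of the map and of minors of its real derivative. -/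
theorem contDiffAt_pullField [FiniteDimensional ℝ E] {Ω : DiffForm 𝓘(ℂ, Cn m) N ℂ m}
    (hΩ : IsSmoothForm Ω) (hP : ContMDiff I 𝓘(ℝ, Cn m) ∞ P) {x₀ : M} {y₁ : E}
    (hy₁ : y₁ ∈ (extChartAt I x₀).target) :
    ContDiffAt ℝ ∞ (formInChart (pullField I Ω P) x₀) y₁ := by
  refine ContDiffAt.congr_of_eventuallyEq ?_ (formInChart_pullField_eventuallyEq Ω hP hy₁)
  have hQ := contDiffAt_mapInChart hP hy₁
  have hΩ' := IsSmoothForm.contDiffAt hΩ (mem_extChartAt_target (P ((extChartAt I x₀).symm y₁)))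
  rw [← contDiffWithinAt_univ]
  refine contDiffWithinAt_alternating fun v => ?_
  rw [contDiffWithinAt_univ]
  simp only [pullForm_apply]
  have heq := fun y => apply_eq_topCoeff_mul_det
    (formInChart Ω (P ((extChartAt I x₀).symm y₁))
          (mapInChart m I P x₀ (P ((extChartAt I x₀).symm y₁)) y))
    (fun i => fderiv ℝ (mapInChart m I P x₀ (P ((extChartAt I x₀).symm y₁))) y (v i))
  refine ContDiffAt.congr_of_eventuallyEq ?_ (Filter.Eventually.of_forall heq)
  refine ContDiffAt.mul ?_ ?_
  · have h1 : ContDiffAt ℂ ∞ (fun z => topCoeff (formInChart Ω (P ((extChartAt I x₀).symm y₁)) z))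
        (extChartAt 𝓘(ℂ, Cn m) (P ((extChartAt I x₀).symm y₁)) (P ((extChartAt I x₀).symm y₁))) :=
      (ContinuousAlternatingMap.apply ℂ (Cn m) ℂ fun i =>
        EuclideanSpace.single i (1 : ℂ)).contDiff.contDiffAt.comp _ hΩ'
    exact (h1.restrict_scalars ℝ).comp y₁ hQ
  · simp only [Matrix.det_apply]
    have h2 := hQ.fderiv_right (m := ∞) (by simp)
    refine ContDiffAt.sum fun σ _ => ContDiffAt.const_smul _ (contDiffAt_prod fun i _ => ?_)
    exact ((EuclideanSpace.proj (𝕜 := ℂ) (σ i) : Cn m →L[ℂ] ℂ).restrictScalars ℝ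
      ).contDiff.contDiffAt.comp y₁ (h2.clm_apply contDiffAt_const)

theorem isSmoothForm_pullField [FiniteDimensional ℝ E] {Ω : DiffForm 𝓘(ℂ, Cn m) N ℂ m}
    (hΩ : IsSmoothForm Ω) (hP : ContMDiff I 𝓘(ℝ, Cn m) ∞ P) : IsSmoothForm (pullField I Ω P) :=
  fun _ _ hy => (contDiffAt_pullField hΩ hP hy).contDiffWithinAt

/-- The pull-back of a holomorphic form of top degree is closed. -/
theorem extDeriv_pullField {Ω : DiffForm 𝓘(ℂ, Cn m) N ℂ m}
    (hΩ : IsSmoothForm Ω) (hP : ContMDiff I 𝓘(ℝ, Cn m) ∞ P) {x₀ : M} {y₁ : E}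
    (hy₁ : y₁ ∈ (extChartAt I x₀).target) :
    extDeriv (formInChart (pullField I Ω P) x₀) y₁ = 0 := by
  rw [(formInChart_pullField_eventuallyEq Ω hP hy₁).extDeriv_eq]
  have hd := (IsSmoothForm.contDiffAt hΩ
    (mem_extChartAt_target (P ((extChartAt I x₀).symm y₁)))).differentiableAt (by simp)
  have hd' : DifferentiableAt ℝ (fun z => (formInChart Ω (P ((extChartAt I x₀).symm y₁)) z
      ).restrictScalars ℝ) (mapInChart m I P x₀ (P ((extChartAt I x₀).symm y₁)) y₁) :=
    (ContinuousAlternatingMap.restrictScalarsCLM (𝕜 := ℂ) (E := Cn m) (F := ℂ) (ι := Fin m)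
      ℝ).differentiableAt.comp _ (hd.restrictScalars ℝ)
  have h1 := extDeriv_pullback hd' (contDiffAt_mapInChart hP hy₁)
    (by
      rw [minSmoothness_of_isRCLikeNormedField]
      exact WithTop.coe_le_coe.2 (le_top : (2 : ℕ∞) ≤ ⊤))
  have h2 : extDeriv (fun z => (formInChart Ω (P ((extChartAt I x₀).symm y₁)) z
      ).restrictScalars ℝ) (mapInChart m I P x₀ (P ((extChartAt I x₀).symm y₁)) y₁) = 0 :=
    extDeriv_restrictScalars_eq_zero hd
  rw [h2] at h1
  exact h1

/-- `d (q ∧ Re (c α)) = 0` for the pull-back `α` of a holomorphic volume form, if `dq` is the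
pull-back of a `2`-form of type `(1, 1)`, written as the antisymmetrisation of a form `k` that
is complex linear in the second argument. -/
theorem extD_wedge_pullField_eq_zero [FiniteDimensional ℝ E] {Ω : DiffForm 𝓘(ℂ, Cn m) N ℂ m}
    (hΩ : IsSmoothForm Ω) (hP : ContMDiff I 𝓘(ℝ, Cn m) ∞ P) {q : DiffForm I M ℝ 1}
    (hq : IsSmoothForm q) (c : ℂ) (x : M) (k : Cn m →L[ℝ] Cn m →L[ℂ] ℂ)
    (hk : ∀ u v : TangentSpace I x, ((extD q x ![u, v] : ℝ) : ℂ) =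
      k (mfderiv I 𝓘(ℝ, Cn m) P x u) (mfderiv I 𝓘(ℝ, Cn m) P x v) -
      k (mfderiv I 𝓘(ℝ, Cn m) P x v) (mfderiv I 𝓘(ℝ, Cn m) P x u)) :
    extD (fun x => wedge (q x) (reForm c (pullField I Ω P x))) x = 0 := by
  have : IsManifold I 1 M := IsManifold.of_le (n := ∞) (by simp)
  rw [extD_eq]
  set y := extChartAt I x x with hy
  have hyt : y ∈ (extChartAt I x).target := mem_extChartAt_target x
  have hqd : DifferentiableAt ℝ (formInChart q x) y :=
    (hq.contDiffAt hyt).differentiableAt (by simp)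
  have hαd : DifferentiableAt ℝ (formInChart (pullField I Ω P) x) y :=
    (contDiffAt_pullField hΩ hP hyt).differentiableAt (by simp)
  have hqd' : DifferentiableAt ℝ (fun z => oneFormCLM (formInChart q x z)) y :=
    oneFormCLM.differentiableAt.comp y hqd
  rw [formInChart_wedge]
  refine extDeriv_reForm_eq_zero (add_comm 1 m) c
    (b := fun z => covWedge m (oneFormCLM (formInChart q x z)) (formInChart (pullField I Ω P) x z))
    ?_ ?_ ?_
  · exact (ContinuousLinearMap.hasFDerivAt_of_bilinear (covWedge m) hqd'.hasFDerivAt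
      hαd.hasFDerivAt).differentiableAt
  · exact Filter.Eventually.of_forall fun z v => wedge_reForm_eq_covWedge (formInChart q x z)
      ((mfderiv I 𝓘(ℝ, Cn m) P ((extChartAt I x).symm z)) ∘L
        (mfderiv 𝓘(ℝ, E) I (extChartAt I x).symm z)) (Ω (P ((extChartAt I x).symm z))) c v
  · -- at `x` itself the chart is the identity on tangent vectors
    let L : E →L[ℝ] Cn m := mfderiv I 𝓘(ℝ, Cn m) P x
    have hα : ∃ Ω', formInChart (pullField I Ω P) x y = pullForm Ω' L := by
      refine ⟨Ω (P ((extChartAt I x).symm y)), ?_⟩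
      have h1 : ∀ x', x' = x → (mfderiv I 𝓘(ℝ, Cn m) P x' : E →L[ℝ] Cn m) = L := by
        rintro _ rfl; rfl
      have h2 := h1 _ (extChartAt_to_inv (I := I) x)
      ext v
      refine congrArg (Ω (P ((extChartAt I x).symm y))) (funext fun i => ?_)
      change (mfderiv I 𝓘(ℝ, Cn m) P ((extChartAt I x).symm (extChartAt I x x)) : E →L[ℝ] Cn m)
        (mfderiv 𝓘(ℝ, E) I (extChartAt I x).symm (extChartAt I x x) (v i)) = _
      rw [h2, mfderiv_extChartAt_symm_self]
      rfl
    obtain ⟨Ω', hΩ'⟩ := hα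
    let R : (Cn m →L[ℂ] ℂ) →L[ℝ] (Cn m →L[ℝ] ℂ) :=
      ContinuousLinearMap.restrictScalarsL ℂ (Cn m) ℂ ℝ ℝ
    let B : E →L[ℝ] E →L[ℝ] ℂ :=
      ((ContinuousLinearMap.compL ℝ E (Cn m) ℂ).flip L) ∘L R ∘L k ∘L L
    have hB : ∀ u, B u = ((k (L u)).restrictScalars ℝ) ∘L L := fun u => rfl
    refine extDeriv_covWedge_eq_zero hqd' hαd (extDeriv_pullField hΩ hP hyt) B (fun u v => ?_)
      fun u => ?_
    · have h1 := hk u v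
      rw [extD_eq] at h1
      have h2 : ∀ w, fderiv ℝ (fun z => oneFormCLM (formInChart q x z)) y w =
          oneFormCLM (fderiv ℝ (formInChart q x) y w) := fun w => by
        have h := (oneFormCLM.hasFDerivAt.comp y hqd.hasFDerivAt).fderiv
        exact congrArg (fun f => f w) h
      rw [h2, h2, oneFormCLM_apply, oneFormCLM_apply]
      have h3 : extDeriv (formInChart q x) y ![u, v] =
          fderiv ℝ (formInChart q x) y u ![v] - fderiv ℝ (formInChart q x) y v ![u] := by
        rw [extDeriv, ContinuousAlternatingMap.alternatizeUncurryFin_apply, Fin.sum_univ_two]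
        have h4 : (0 : Fin 2).removeNth ![u, v] = ![v] := by ext i; fin_cases i; rfl
        have h5 : (1 : Fin 2).removeNth ![u, v] = ![u] := by ext i; fin_cases i; rfl
        rw [h4, h5]
        simp [sub_eq_add_neg]
      rw [← h3]
      exact h1
    · rw [hΩ', hB]
      exact alternatizeUncurryFin_smulRight_pullForm Ω' L (k (L u))

end FormsInCharts

/-! ### Forms on the trivial bundle -/

section TrivialBundle

variable {E : Type*} [NormedAddCommGroup E] [NormedSpace ℝ E] {H : Type*} [TopologicalSpace H]
  {I : ModelWithCorners ℝ E H} {S : Type*} [TopologicalSpace S] [ChartedSpace H S]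

theorem extChartAt_prod_symm_apply (x : ℝ × S) (y : ℝ × E) :
    (extChartAt (𝓘(ℝ, ℝ).prod I) x).symm y = (y.1, (extChartAt I x.2).symm y.2) := by
  rw [extChartAt_prod]
  rfl

theorem mem_extChartAt_prod_target {x : ℝ × S} {y : ℝ × E} :
    y ∈ (extChartAt (𝓘(ℝ, ℝ).prod I) x).target ↔ y.2 ∈ (extChartAt I x.2).target := by
  rw [extChartAt_prod, PartialEquiv.prod_target, Set.mem_prod]
  have h : (extChartAt 𝓘(ℝ, ℝ) x.1).target = Set.univ := by
    simp only [chartAt_self_eq, mfld_simps]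
  rw [h]
  exact and_iff_right (Set.mem_univ _)

variable (I) in
/-- The differential of the coordinate function `t` of `ℝ × S`, on the tangent spaces of the
product, which are `ℝ × E` by definition. -/
def dtForm : DiffForm (𝓘(ℝ, ℝ).prod I) (ℝ × S) ℝ 1 := fun _ =>
  ContinuousAlternatingMap.ofSubsingleton ℝ (ℝ × E) ℝ (0 : Fin 1) (ContinuousLinearMap.fst ℝ ℝ E)

/-- The pull-back of a `1`-form on `S` to `ℝ × S`. -/
def sndPullback (θ : DiffForm I S ℝ 1) : DiffForm (𝓘(ℝ, ℝ).prod I) (ℝ × S) ℝ 1 := fun x =>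
  (θ x.2).compContinuousLinearMap (projDeriv x)

theorem sndPullback_apply (θ : DiffForm I S ℝ 1) (x : ℝ × S)
    (v : TangentSpace (𝓘(ℝ, ℝ).prod I) x) : sndPullback θ x ![v] = θ x.2 ![projDeriv x v] :=
  congrArg (θ x.2) (funext fun i => by fin_cases i; rfl)

theorem projDeriv_eq (x : ℝ × S) : projDeriv (I := I) x = ContinuousLinearMap.snd ℝ ℝ E :=
  mfderiv_snd

theorem fundamentalField_eq (x : ℝ × S) : fundamentalField (I := I) x = ((1, 0) : ℝ × E) := by
  have h := ((hasMFDerivAt_id (I := 𝓘(ℝ, ℝ)) x.1).prodMk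
    (hasMFDerivAt_const (I := 𝓘(ℝ, ℝ)) (I' := I) x.2 x.1)).mfderiv
  exact congrArg (fun f => f (1 : ℝ)) h

variable [I.Boundaryless] [IsManifold I ∞ S]

theorem mfderiv_extChartAt_prod_symm {x : ℝ × S} {y : ℝ × E}
    (hy : y ∈ (extChartAt (𝓘(ℝ, ℝ).prod I) x).target) (v : ℝ × E) :
    mfderiv 𝓘(ℝ, ℝ × E) (𝓘(ℝ, ℝ).prod I) (extChartAt (𝓘(ℝ, ℝ).prod I) x).symm y v =
      ((v.1, mfderiv 𝓘(ℝ, E) I (extChartAt I x.2).symm y.2 v.2) : ℝ × E) := by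
  have : IsManifold I 1 S := IsManifold.of_le (n := ∞) (by simp)
  have h1 := (mdifferentiableAt_extChartAt_symm
    (mem_extChartAt_prod_target.1 hy)).hasMFDerivAt.comp y
    (hasFDerivAt_snd (𝕜 := ℝ) (E := ℝ) (F := E) (p := y)).hasMFDerivAt
  have h2 := (hasFDerivAt_fst (𝕜 := ℝ) (E := ℝ) (F := E) (p := y)).hasMFDerivAt.prodMk h1
  have h3 : ((extChartAt (𝓘(ℝ, ℝ).prod I) x).symm : ℝ × E → ℝ × S) =
      fun y => (y.1, (extChartAt I x.2).symm y.2) :=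
    funext fun y => extChartAt_prod_symm_apply x y
  rw [h3]
  exact congrArg (fun f => f v) h2.mfderiv

theorem formInChart_sndPullback (θ : DiffForm I S ℝ 1) {x : ℝ × S} {y : ℝ × E}
    (hy : y ∈ (extChartAt (𝓘(ℝ, ℝ).prod I) x).target) :
    formInChart (sndPullback θ) x y =
      (formInChart θ x.2 y.2).compContinuousLinearMap (ContinuousLinearMap.snd ℝ ℝ E) := by
  ext v
  have h1 : ∀ z, z = (y.1, (extChartAt I x.2).symm y.2) → ∀ w : Fin 1 → ℝ × E,
    sndPullback θ z w = θ ((extChartAt I x.2).symm y.2) fun i => (w i).2 := by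
    rintro _ rfl w
    change θ _ (fun i => projDeriv (I := I) _ (w i)) = _
    rw [projDeriv_eq]
    rfl
  refine (h1 _ (extChartAt_prod_symm_apply x y) _).trans ?_
  exact congrArg (θ ((extChartAt I x.2).symm y.2)) (funext fun i =>
    congrArg (Prod.snd : ℝ × E → E) (mfderiv_extChartAt_prod_symm hy (v i)))

theorem formInChart_dtForm {x : ℝ × S} {y : ℝ × E}
    (hy : y ∈ (extChartAt (𝓘(ℝ, ℝ).prod I) x).target) :
    formInChart (dtForm I) x y = ContinuousAlternatingMap.ofSubsingleton ℝ (ℝ × E) ℝ (0 : Fin 1)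
      (ContinuousLinearMap.fst ℝ ℝ E) := by
  ext v
  have h := congrArg (Prod.fst : ℝ × E → ℝ) (mfderiv_extChartAt_prod_symm hy (v 0))
  exact h

theorem isSmoothForm_dtForm : IsSmoothForm (dtForm I (S := S)) := fun _ =>
  contDiffOn_const.congr fun _ hy => formInChart_dtForm hy

theorem IsSmoothForm.sndPullback {θ : DiffForm I S ℝ 1} (hθ : IsSmoothForm θ) :
    IsSmoothForm (sndPullback θ) := by
  intro x
  refine ContDiffOn.congr ?_ fun y hy => formInChart_sndPullback θ hy
  refine (ContinuousAlternatingMap.compContinuousLinearMapCLM (F := ℝ) (ι := Fin 1)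
    (ContinuousLinearMap.snd ℝ ℝ E)).contDiff.comp_contDiffOn ?_
  exact (hθ x.2).comp contDiff_snd.contDiffOn fun y hy => mem_extChartAt_prod_target.1 hy

theorem extD_sndPullback {θ : DiffForm I S ℝ 1} (hθ : IsSmoothForm θ) (x : ℝ × S)
    (u v : TangentSpace (𝓘(ℝ, ℝ).prod I) x) :
    extD (sndPullback θ) x ![u, v] = extD θ x.2 ![projDeriv x u, projDeriv x v] := by
  have : IsManifold I 1 S := IsManifold.of_le (n := ∞) (by simp)
  have hy := mem_extChartAt_target (I := 𝓘(ℝ, ℝ).prod I) x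
  have h1 : formInChart (_root_.sndPullback θ) x =ᶠ[𝓝 (extChartAt (𝓘(ℝ, ℝ).prod I) x x)] fun y =>
      (formInChart θ x.2 y.2).compContinuousLinearMap
        (fderiv ℝ (Prod.snd : ℝ × E → E) y) := by
    filter_upwards [(isOpen_extChartAt_target x).mem_nhds hy] with y hy
    rw [fderiv_snd]
    exact formInChart_sndPullback θ hy
  have h2 : (extChartAt (𝓘(ℝ, ℝ).prod I) x x).2 = extChartAt I x.2 x.2 := by
    rw [extChartAt_prod]; rfl
  rw [extD_eq, extD_eq, h1.extDeriv_eq]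
  have h3 := extDeriv_pullback (r := ∞) (x := extChartAt (𝓘(ℝ, ℝ).prod I) x x)
    (f := (Prod.snd : ℝ × E → E))
    ((hθ.contDiffAt (by rw [h2]; exact mem_extChartAt_target x.2)).differentiableAt (by simp))
    contDiff_snd.contDiffAt
    (by
      rw [minSmoothness_of_isRCLikeNormedField]
      exact WithTop.coe_le_coe.2 (le_top : (2 : ℕ∞) ≤ ⊤))
  rw [fderiv_snd, h2] at h3
  refine (congrArg (fun f => f ![u, v]) h3).trans ?_
  rw [projDeriv_eq]
  refine congrArg (extDeriv (formInChart θ x.2) (extChartAt I x.2 x.2)) (funext fun i => ?_)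
  fin_cases i <;> rfl

variable (I) in
/-- The `1`-form `g(∂/∂t, ·)`. -/
def fundamentalCoform (g : BilinField (𝓘(ℝ, ℝ).prod I) (ℝ × S)) :
    DiffForm (𝓘(ℝ, ℝ).prod I) (ℝ × S) ℝ 1 := fun x =>
  ContinuousAlternatingMap.ofSubsingleton ℝ (ℝ × E) ℝ (0 : Fin 1) (g x (fundamentalField x))

theorem IsSmoothBilin.fundamentalCoform [FiniteDimensional ℝ E]
    {g : BilinField (𝓘(ℝ, ℝ).prod I) (ℝ × S)}
    (hg : IsSmoothBilin g) : IsSmoothForm (fundamentalCoform I g) := by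
  intro x y hy
  refine contDiffWithinAt_alternating fun v => ?_
  refine ((hg x (1, 0) (v 0)).congr fun z hz => ?_) y hy
  have h : fundamentalField (I := I) ((extChartAt (𝓘(ℝ, ℝ).prod I) x).symm z) =
      mfderiv 𝓘(ℝ, ℝ × E) (𝓘(ℝ, ℝ).prod I) (extChartAt (𝓘(ℝ, ℝ).prod I) x).symm z
        ((1, 0) : ℝ × E) := by
    rw [mfderiv_extChartAt_prod_symm hz, fundamentalField_eq]
    exact congrArg (fun w => ((1, w) : ℝ × E)) (map_zero _).symm
  rw [← h]
  rfl

end TrivialBundle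

/-! ### Volume forms of Lorentzian manifolds -/

section VolumeForm

/-- The square of a volume is minus the Gram determinant, in units of an orthonormal basis. -/
theorem IsLorentzBasis.sq_apply_eq {V : Type*} [AddCommGroup V] [Module ℝ V] [TopologicalSpace V]
    {g : V →L[ℝ] V →L[ℝ] ℝ} {n : ℕ} (hn : 0 < n) {e : Module.Basis (Fin n) ℝ V}
    (he : IsLorentzBasis g e) (Φ : V [⋀^Fin n]→L[ℝ] ℝ) (w : Fin n → V) :
    Φ w ^ 2 = -(Matrix.of fun i j => g (w i) (w j)).det * Φ e ^ 2 := by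
  have h1 : Φ w = Φ e * (e.toMatrix w).det := by
    have h := congrArg (fun f => f w) (Φ.toAlternatingMap.eq_smul_basis_det e)
    simpa [Module.Basis.det_apply] using h
  have h2 : (Matrix.of fun i j => g (w i) (w j)) =
      (e.toMatrix w).transpose * Matrix.diagonal lorentzSign * e.toMatrix w := by
    ext i j
    rw [Matrix.mul_apply]
    simp only [Matrix.mul_diagonal, Matrix.transpose_apply, Module.Basis.toMatrix_apply,
      Matrix.of_apply]
    conv_lhs => rw [← e.sum_repr (w i), ← e.sum_repr (w j)]
    simp only [map_sum, map_smul, sum_apply, smul_apply,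
      smul_eq_mul]
    refine Finset.sum_congr rfl fun k _ => ?_
    rw [Finset.sum_eq_single k]
    · rw [he, if_pos rfl]; ring
    · intro l _ hl
      rw [he, if_neg hl]; ring
    · simp
  rw [h2, Matrix.det_mul, Matrix.det_mul, Matrix.det_transpose, Matrix.det_diagonal,
    prod_lorentzSign hn, h1]
  ring

theorem IsLorentzBasis.sq_apply_eq_sq {V : Type*} [AddCommGroup V] [Module ℝ V]
    [TopologicalSpace V] {g : V →L[ℝ] V →L[ℝ] ℝ} {n : ℕ} (hn : 0 < n)
    {e e' : Module.Basis (Fin n) ℝ V} (he : IsLorentzBasis g e) (he' : IsLorentzBasis g e')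
    (Φ : V [⋀^Fin n]→L[ℝ] ℝ) : Φ e' ^ 2 = Φ e ^ 2 := by
  have h : (Matrix.of fun i j => g (e' i) (e' j)) = Matrix.diagonal lorentzSign := by
    ext i j
    rw [Matrix.of_apply, he', Matrix.diagonal_apply]
  rw [he.sq_apply_eq hn Φ e', h, Matrix.det_diagonal, prod_lorentzSign hn]
  ring

variable {E : Type*} [NormedAddCommGroup E] [NormedSpace ℝ E]
  {H : Type*} [TopologicalSpace H] {I : ModelWithCorners ℝ E H} [I.Boundaryless]
  {M : Type*} [TopologicalSpace M] [ChartedSpace H M] [IsManifold I ∞ M]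

/-- A nowhere vanishing form of top degree on a Lorentzian manifold can be rescaled to a volume
form. -/
theorem LorentzMetric.exists_isVolumeForm {n : ℕ} (hn : 0 < n) (g : LorentzMetric I M n)
    {Φ : DiffForm I M ℝ n} (hΦ : IsSmoothForm Φ)
    (h0 : ∀ (x : M) (e : Module.Basis (Fin n) ℝ (TangentSpace I x)), IsLorentzBasis (g.g x) e →
      Φ x e ≠ 0) :
    ∃ r : M → ℝ, (∀ x, 0 < r x) ∧ IsVolumeForm g fun x => r x • Φ x := by
  have : IsManifold I 1 M := IsManifold.of_le (n := ∞) (by simp)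
  choose e he using g.lorentz
  -- the factor does not depend on the choice of `e`, and by `IsLorentzBasis.sq_apply_eq` its square
  -- is a quotient of smooth functions
  refine ⟨fun x => |Φ x (e x)|⁻¹, fun x => inv_pos.2 (abs_pos.2 (h0 x _ (he x))), ?_, ?_⟩
  · intro x₀
    let b : Module.Basis (Fin n) ℝ E := e x₀
    let G : E → ℝ := fun y => (Matrix.of fun i j => g.g ((extChartAt I x₀).symm y)
      (mfderiv 𝓘(ℝ, E) I (extChartAt I x₀).symm y (b i))
      (mfderiv 𝓘(ℝ, E) I (extChartAt I x₀).symm y (b j))).det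
    have hG : ContDiffOn ℝ ∞ G (extChartAt I x₀).target := by
      simp only [G, Matrix.det_apply]
      refine ContDiffOn.sum fun σ _ => ContDiffOn.const_smul _ (contDiffOn_prod fun i _ => ?_)
      exact g.smooth x₀ _ _
    have hb : ∀ y ∈ (extChartAt I x₀).target, formInChart Φ x₀ y b ≠ 0 := by
      intro y hy h
      obtain ⟨A, hA⟩ := isInvertible_mfderiv_extChartAt_symm (I := I) hy
      have h1 : Φ ((extChartAt I x₀).symm y) (b.map A.toLinearEquiv) = 0 := by
        rw [← h]
        refine congrArg (Φ ((extChartAt I x₀).symm y)) (funext fun i => ?_)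
        exact congrArg (fun f => f (b i)) hA
      have h2 := (AlternatingMap.map_basis_eq_zero_iff (b.map A.toLinearEquiv)
        (Φ ((extChartAt I x₀).symm y)).toAlternatingMap).1 h1
      refine h0 _ _ (he ((extChartAt I x₀).symm y)) ?_
      exact congrArg (fun f => f (e ((extChartAt I x₀).symm y))) h2
    have hΦb : ContDiffOn ℝ ∞ (fun y => formInChart Φ x₀ y b) (extChartAt I x₀).target :=
      (ContinuousAlternatingMap.apply ℝ E ℝ b).contDiff.comp_contDiffOn (hΦ x₀)
    have hsq : ∀ y, formInChart Φ x₀ y b ^ 2 = -G y *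
        Φ ((extChartAt I x₀).symm y) (e ((extChartAt I x₀).symm y)) ^ 2 := fun y =>
      (he ((extChartAt I x₀).symm y)).sq_apply_eq hn (Φ ((extChartAt I x₀).symm y))
        fun i => mfderiv 𝓘(ℝ, E) I (extChartAt I x₀).symm y (b i)
    have hr : ContDiffOn ℝ ∞ (fun y => |Φ ((extChartAt I x₀).symm y)
        (e ((extChartAt I x₀).symm y))|⁻¹) (extChartAt I x₀).target := by
      have h1 : ∀ y ∈ (extChartAt I x₀).target, -G y / formInChart Φ x₀ y b ^ 2 =
          |Φ ((extChartAt I x₀).symm y) (e ((extChartAt I x₀).symm y))|⁻¹ ^ 2 := by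
        intro y hy
        have h2 := hsq y
        have h3 := h0 _ _ (he ((extChartAt I x₀).symm y))
        rw [inv_pow, sq_abs, div_eq_iff (pow_ne_zero 2 (hb y hy)), h2, mul_comm (-G y),
          inv_mul_cancel_left₀ (pow_ne_zero 2 h3)]
      refine ContDiffOn.congr (f := fun y => Real.sqrt (-G y / formInChart Φ x₀ y b ^ 2)) ?_ ?_
      · refine ContDiffOn.sqrt (hG.neg.div (hΦb.pow 2) fun y hy => pow_ne_zero 2 (hb y hy))
          fun y hy => ?_
        rw [h1 y hy]
        exact pow_ne_zero 2 (inv_ne_zero (abs_ne_zero.2 (h0 _ _ (he _))))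
      · intro y hy
        rw [h1 y hy, Real.sqrt_sq (inv_nonneg.2 (abs_nonneg _))]
    exact hr.smul (hΦ x₀)
  · intro x e' he'
    have h1 : |Φ x e'| = |Φ x (e x)| := (sq_eq_sq_iff_abs_eq_abs _ _).1
      ((he x).sq_apply_eq_sq hn he' (Φ x))
    change |(|Φ x (e x)|⁻¹ * Φ x e')| = 1
    rw [abs_mul, abs_inv, abs_abs, h1, inv_mul_cancel₀ (abs_ne_zero.2 (h0 x _ (he x)))]

end VolumeForm

/-! ### The Kähler quotient of a regular Sasaki manifold -/

section HermitianForm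

/-- The Kähler form `G(i a, b)` of a Hermitian scalar product `G` on `ℂᵐ` is the antisymmetrisation
of `-i/2` times the Hermitian form `G(a, b) - i G(a, i b)`, which is complex linear in `b`. -/
theorem exists_complexLinear_antisymm {m : ℕ} (G : Cn m →L[ℝ] Cn m →L[ℝ] ℝ)
    (hsymm : ∀ a b, G a b = G b a) (hherm : ∀ a b, G (Complex.I • a) (Complex.I • b) = G a b) :
    ∃ k : Cn m →L[ℝ] Cn m →L[ℂ] ℂ, ∀ a b,
      ((G (Complex.I • a) b : ℝ) : ℂ) = k a b - k b a := by
  have hf : ∀ (f : Cn m →L[ℝ] ℝ) b, StrongDual.extendRCLike (𝕜 := ℂ) f b =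
      (f b : ℂ) - Complex.I * (f (Complex.I • b) : ℂ) := fun _ _ => rfl
  let k : Cn m →ₗ[ℝ] Cn m →L[ℂ] ℂ :=
    { toFun := fun a => (-(Complex.I / 2)) • StrongDual.extendRCLike (𝕜 := ℂ) (G a)
      map_add' := fun a b => by
        ext v
        simp only [map_add, smul_apply, add_apply,
          hf, smul_eq_mul]
        push_cast
        ring
      map_smul' := fun c a => by
        ext v
        simp only [map_smul, smul_apply,
          hf, smul_eq_mul, RingHom.id_apply, Complex.real_smul]
        push_cast
        ring }
  have hk : ∀ a b, k a b = -(Complex.I / 2) * (G a b - Complex.I * G a (Complex.I • b)) := by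
    intro a b
    change _ * StrongDual.extendRCLike (𝕜 := ℂ) (G a) b = _
    rw [hf]
  have hskew : ∀ a b, G a (Complex.I • b) = -G (Complex.I • a) b := by
    intro a b
    rw [← hherm, smul_smul, Complex.I_mul_I, neg_one_smul, map_neg]
  refine ⟨LinearMap.toContinuousLinearMap k, fun a b => ?_⟩
  change _ = k a b - k b a
  rw [hk, hk, hsymm b a, hskew, hsymm b]
  push_cast
  linear_combination (G (Complex.I • a) b : ℂ) * Complex.I_sq

end HermitianForm

section Sasaki

variable {m : ℕ} {E : Type*} [NormedAddCommGroup E] [NormedSpace ℝ E] {H : Type*}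
  [TopologicalSpace H] {I : ModelWithCorners ℝ E H} {S : Type*} [TopologicalSpace S]
  [ChartedSpace H S] [IsManifold I ∞ S] {N : Type*} [TopologicalSpace N] [ChartedSpace (Cn m) N]
  {𝒮 : SasakiManifold I S} {K : KahlerMetric m N} {π : S → N}

/-- The projection to the orbit space is constant along the orbits of the Reeb field. -/
theorem IsAssociatedKahler.mfderiv_reeb (hπ : IsAssociatedKahler 𝒮 K π) (h𝒮 : 𝒮.IsRegular)
    (x : S) : mfderiv I 𝓘(ℝ, Cn m) π x (𝒮.Z x) = 0 := by
  obtain ⟨T, _, -, -, h⟩ := h𝒮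
  have hγ := h x
  set γ : ℝ → S := fun t : ℝ => (t : AddCircle T) +ᵥ x with hγ_def
  have h0 : γ 0 = x := by
    rw [hγ_def]
    change ((0 : ℝ) : AddCircle T) +ᵥ x = x
    rw [AddCircle.coe_zero, zero_vadd]
  have h1 := ((hπ.smooth.mdifferentiable (by simp) (γ 0)).hasMFDerivAt).comp 0 (hγ 0)
  have h2 : π ∘ γ = fun _ => π x :=
    funext fun t => ((hπ.fibres x (γ t)).2 ⟨γ, hγ, h0, t, rfl⟩).symm
  rw [h2] at h1
  have h3 := hasMFDerivAt_unique h1 (hasMFDerivAt_const (π x) (0 : ℝ))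
  have h4 : ∀ z, z = x → mfderiv I 𝓘(ℝ, Cn m) π z (𝒮.Z z) = 0 →
      mfderiv I 𝓘(ℝ, Cn m) π x (𝒮.Z x) = 0 := by
    rintro _ rfl h; exact h
  refine h4 _ h0 ?_
  have h5 := congrArg (fun f : ℝ →L[ℝ] Cn m => f 1) h3
  have h6 : mfderiv I 𝓘(ℝ, Cn m) π (γ 0) ((1 : ℝ) • 𝒮.Z (γ 0)) = 0 := h5
  rwa [one_smul] at h6

/-- The splitting of a tangent vector into its contact and Reeb components. -/
theorem exists_add_smul_reeb (𝒮 : SasakiManifold I S) (x : S) (u : TangentSpace I x) :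
    ∃ u₀, 𝒮.θ x ![u₀] = 0 ∧ u = u₀ + 𝒮.θ x ![u] • 𝒮.Z x := by
  refine ⟨u - 𝒮.θ x ![u] • 𝒮.Z x, ?_, (sub_add_cancel _ _).symm⟩
  have h := (oneFormLin (𝒮.θ x)).map_sub u (𝒮.θ x ![u] • 𝒮.Z x)
  rw [map_smul] at h
  simpa [𝒮.θ_Z] using h

/-- The differential of the contact form is the pull-back of the Kähler form. -/
theorem IsAssociatedKahler.extD_contact_eq (hπ : IsAssociatedKahler 𝒮 K π) (h𝒮 : 𝒮.IsRegular)
    (x : S) (u v : TangentSpace I x) : extD 𝒮.θ x ![u, v] =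
      K.g (π x) (complexStructure (π x) (mfderiv I 𝓘(ℝ, Cn m) π x u))
        (mfderiv I 𝓘(ℝ, Cn m) π x v) := by
  have hswap : ∀ u v, extD 𝒮.θ x ![u, v] = -extD 𝒮.θ x ![v, u] := by
    intro u v
    have h := (extD 𝒮.θ x).toAlternatingMap.map_swap ![v, u] (Fin.zero_ne_one)
    rw [← show ![u, v] = ![v, u] ∘ Equiv.swap 0 1 by ext i; fin_cases i <;> simp] at h
    exact h
  have hZ : ∀ (u₀ : TangentSpace I x) (a : ℝ) (v : TangentSpace I x),
      extD 𝒮.θ x ![u₀ + a • 𝒮.Z x, v] = extD 𝒮.θ x ![u₀, v] := by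
    intro u₀ a v
    have h1 := (extD 𝒮.θ x).vecCons_add ![v] u₀ (a • 𝒮.Z x)
    have h2 := (extD 𝒮.θ x).vecCons_smul ![v] a (𝒮.Z x)
    rw [𝒮.dθ_Z, smul_zero] at h2
    rw [h1, h2, add_zero]
  have hJJ : ∀ (y : N) (w : TangentSpace 𝓘(ℝ, Cn m) y),
      complexStructure y (complexStructure y w) = -w := by
    intro y w
    have h : ∀ w : Cn m, Complex.I • (Complex.I • w) = -w := fun w => by
      rw [smul_smul, Complex.I_mul_I, neg_one_smul]
    exact h w
  have hdπ : ∀ (u₀ : TangentSpace I x) (a : ℝ), mfderiv I 𝓘(ℝ, Cn m) π x (u₀ + a • 𝒮.Z x) =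
      mfderiv I 𝓘(ℝ, Cn m) π x u₀ := by
    intro u₀ a
    rw [map_add, map_smul, hπ.mfderiv_reeb h𝒮, smul_zero, add_zero]
  obtain ⟨u₀, hu₀, hu⟩ := exists_add_smul_reeb 𝒮 x u
  obtain ⟨v₀, hv₀, hv⟩ := exists_add_smul_reeb 𝒮 x v
  generalize 𝒮.θ x ![u] = a at hu
  generalize 𝒮.θ x ![v] = b at hv
  subst hu hv
  rw [hZ, hswap, hZ, ← hswap, hdπ, hdπ]
  have hneg : 𝒮.θ x ![-𝒮.J x v₀] = 0 := by
    have h := (oneFormLin (𝒮.θ x)).map_neg (𝒮.J x v₀)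
    simpa [𝒮.J_mem x v₀ hv₀] using h
  have h1 := hπ.metric x u₀ (-𝒮.J x v₀) hu₀ hneg
  rw [SasakiManifold.levi, map_neg (𝒮.J x), 𝒮.J_J x v₀ hv₀, neg_neg, map_neg,
    hπ.complex x v₀ hv₀, map_neg] at h1
  rw [← h1, ← K.hermitian, hJJ, map_neg, neg_neg]

end Sasaki

section PlaneWave

variable {V : Type*} [AddCommGroup V] [Module ℝ V] [TopologicalSpace V] {m : ℕ}

/-- The form `q ∧ Re α` does not vanish, if `α` is the pull-back of a complex volume form by a map
`L` that is onto on the kernel of `q ≠ 0`. -/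
theorem wedge_reForm_pullForm_ne_zero (hm : 0 < m) {q : V [⋀^Fin 1]→L[ℝ] ℝ} {n : V}
    (hn : q ![n] = 1) {L : V →L[ℝ] Cn m} (hL : ∀ y, ∃ v, q ![v] = 0 ∧ L v = y)
    {Ω : Cn m [⋀^Fin m]→L[ℂ] ℂ} (hΩ : Ω ≠ 0) : wedge q (reForm 1 (pullForm Ω L)) ≠ 0 := by
  intro h0
  let a : Fin m → ℂ := fun k => if k = ⟨0, hm⟩ then star (topCoeff Ω) else 1
  -- the factor of the first vector makes the value of the form `|topCoeff Ω|²`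
  choose v hv hLv using fun k => hL (EuclideanSpace.single k (a k))
  have h := congrArg (fun f => f fun i => Sum.elim (fun _ => n) v (finSumFinEquiv.symm i)) h0
  have hdet : (covMatrix q L fun i => Sum.elim (fun _ => n) v (finSumFinEquiv.symm i)).det =
      star (topCoeff Ω) := by
    rw [← Matrix.det_submatrix_equiv_self finSumFinEquiv]
    have h1 : (covMatrix q L fun i => Sum.elim (fun _ => n) v (finSumFinEquiv.symm i)).submatrix
        finSumFinEquiv finSumFinEquiv = Matrix.fromBlocks 1 0
          (Matrix.of fun k (_ : Fin 1) => L n k) (Matrix.diagonal a) := by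
      ext i j
      rcases i with i | i <;> rcases j with j | j
      · simp [covMatrix, covRow, hn, Subsingleton.elim i j]
      · simp [covMatrix, covRow, hv]
      · simp [covMatrix, covRow]
      · by_cases hij : i = j <;>
          simp [covMatrix, covRow, hLv, PiLp.single_apply, hij]
    rw [h1, Matrix.det_fromBlocks_zero₁₂, Matrix.det_one, one_mul, Matrix.det_diagonal]
    simp [a]
  change wedge q (reForm 1 (pullForm Ω L)) _ = 0 at h
  rw [wedge_reForm_apply, hdet, one_mul, Complex.star_def, Complex.mul_conj,
    Complex.ofReal_re] at h
  exact topCoeff_ne_zero hΩ (Complex.normSq_eq_zero.1 h)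

theorem inFormKernel_reForm_pullForm (c : ℂ) (Ω : Cn m [⋀^Fin m]→L[ℂ] ℂ) {L : V →L[ℝ] Cn m}
    {v : V} (hv : L v = 0) : InFormKernel (reForm c (pullForm Ω L)) v := by
  intro w i
  rw [reForm_apply, pullForm_apply, Ω.map_coord_zero i (by rw [Function.update_self, hv]),
    mul_zero, Complex.zero_re]

theorem exists_smul_of_ker_eq {q P : V [⋀^Fin 1]→L[ℝ] ℝ} (h : ∀ v, P ![v] = 0 ↔ q ![v] = 0)
    {n : V} (hn : q ![n] = 1) : ∃ f : ℝ, f ≠ 0 ∧ q = f • P := by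
  have hP : P ![n] ≠ 0 := fun h0 => one_ne_zero (hn.symm.trans ((h n).1 h0))
  refine ⟨(P ![n])⁻¹, inv_ne_zero hP, ?_⟩
  ext w
  have hw : w = ![w 0] := by ext i; fin_cases i; rfl
  rw [hw]
  have h1 : oneFormLin P (w 0 - q ![w 0] • n) = 0 := by
    rw [oneFormLin_apply, h, ← oneFormLin_apply, map_sub, map_smul]
    simp [hn]
  rw [map_sub, map_smul, sub_eq_zero] at h1
  simp only [oneFormLin_apply, smul_eq_mul] at h1
  change _ = (P ![n])⁻¹ * P ![w 0]
  rw [h1]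
  field_simp

end PlaneWave

/-! ### Plane waves on manifolds of Kähler–Sasaki type -/

section KahlerSasakiMetric

variable {m : ℕ} {E : Type*} [NormedAddCommGroup E] [NormedSpace ℝ E] {H : Type*}
  [TopologicalSpace H] {I : ModelWithCorners ℝ E H} {S : Type*} [TopologicalSpace S]
  [ChartedSpace H S] [IsManifold I ∞ S] {N : Type*} [TopologicalSpace N] [ChartedSpace (Cn m) N]
  {𝒮 : SasakiManifold I S} {K : KahlerMetric m N} {π : S → N}

theorem contMDiff_comp_snd (hπ : IsAssociatedKahler 𝒮 K π) :
    ContMDiff (𝓘(ℝ, ℝ).prod I) 𝓘(ℝ, Cn m) ∞ fun x : ℝ × S => π x.2 :=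
  hπ.smooth.comp contMDiff_snd

theorem mfderiv_comp_snd (hπ : IsAssociatedKahler 𝒮 K π) (x : ℝ × S)
    (v : TangentSpace (𝓘(ℝ, ℝ).prod I) x) :
    mfderiv (𝓘(ℝ, ℝ).prod I) 𝓘(ℝ, Cn m) (fun x : ℝ × S => π x.2) x v =
      mfderiv I 𝓘(ℝ, Cn m) π x.2 (projDeriv x v) := by
  have h := mfderiv_comp x (hπ.smooth.mdifferentiable (by simp) x.2)
    (mdifferentiableAt_snd (I := 𝓘(ℝ, ℝ)) (I' := I) (x := x))
  exact congrArg (fun f => f v) h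

/-- The tangent spaces of a Lorentzian manifold of Kähler–Sasaki type, with the null vector
`∂/∂t` and the differential of the projection to the Kähler quotient. -/
theorem IsKahlerSasakiMetric.exists_isTransverselyHermitian {n : ℕ}
    {g : LorentzMetric (𝓘(ℝ, ℝ).prod I) (ℝ × S) n} (hg : IsKahlerSasakiMetric 𝒮 g)
    (h𝒮 : 𝒮.IsRegular) (hπ : IsAssociatedKahler 𝒮 K π) (x : ℝ × S) :
    ∃ s : ℝ, IsTransverselyHermitian (g.g x) (fundamentalField x) (fundamentalCoform I g.g x)
      (dtForm I x) (mfderiv (𝓘(ℝ, ℝ).prod I) 𝓘(ℝ, Cn m) (fun x : ℝ × S => π x.2) x)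
      (K.g (π x.2)) s := by
  obtain ⟨σ, -, hσ, hconf⟩ := hg.conformal
  have hp : projDeriv x (fundamentalField x) = (0 : TangentSpace I x.2) := by
    rw [projDeriv_eq, fundamentalField_eq]
    rfl
  have hker : ∀ v, fundamentalCoform I g.g x ![v] = 0 ↔ 𝒮.θ x.2 ![projDeriv x v] = 0 :=
    hg.distribution x
  refine ⟨σ x, ?_⟩
  constructor
  · exact fun v => rfl
  · rw [hker, hp]
    exact (oneFormLin (𝒮.θ x.2)).map_zero
  · change (fundamentalField (I := I) x : ℝ × E).1 = 1
    rw [fundamentalField_eq]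
  · exact (mfderiv_comp_snd hπ x _).trans ((congrArg _ hp).trans (map_zero _))
  · exact hσ x
  · intro u v hu hv
    rw [hker] at hu hv
    rw [hconf x u v hu hv, ← hπ.metric x.2 _ _ hu hv]
    exact congrArg₂ (fun a b => σ x * K.g (π x.2) a b) (mfderiv_comp_snd hπ x u).symm
      (mfderiv_comp_snd hπ x v).symm
  · intro y
    obtain ⟨w, hw⟩ := hπ.submersion x.2 y
    obtain ⟨w₀, hw₀, hww⟩ := exists_add_smul_reeb 𝒮 x.2 w
    have h1 : projDeriv x ((0, w₀) : ℝ × E) = w₀ := by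
      rw [projDeriv_eq]
      rfl
    have h2 : mfderiv I 𝓘(ℝ, Cn m) π x.2 w = mfderiv I 𝓘(ℝ, Cn m) π x.2 w₀ := by
      rw [hww, map_add, map_smul, hπ.mfderiv_reeb h𝒮, smul_zero, add_zero]
    exact ⟨((0, w₀) : ℝ × E), (hker _).2 (by rw [h1, hw₀]),
      (mfderiv_comp_snd hπ x _).trans ((congrArg _ h1).trans (h2.symm.trans hw))⟩
  · exact K.symm _
  · exact K.pos _
  · exact K.hermitian _

end KahlerSasakiMetric

theorem mainTheorem11 {m : ℕ} (hm : 1 ≤ m)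
    {S : Type*} [TopologicalSpace S] [T2Space S] [SecondCountableTopology S]
    [ChartedSpace (EuclideanSpace ℝ (Fin (2 * m + 1))) S] [IsManifold (𝓡 (2 * m + 1)) ∞ S]
    {N : Type*} [TopologicalSpace N] [T2Space N] [SecondCountableTopology N]
    [ChartedSpace (Cn m) N] [IsManifold 𝓘(ℂ, Cn m) ω N]
    (𝒮 : SasakiManifold (𝓡 (2 * m + 1)) S) (h𝒮 : 𝒮.IsRegular)
    (K : KahlerMetric m N) (π : S → N) (hπ : IsAssociatedKahler 𝒮 K π)
    (g : LorentzMetric (𝓘(ℝ, ℝ).prod (𝓡 (2 * m + 1))) (ℝ × S) ((1 + m) + (1 + m)))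
    (hg : IsKahlerSasakiMetric 𝒮 g)
    (hΩ : ∃ Ω : DiffForm 𝓘(ℂ, Cn m) N ℂ m, IsHolomorphicVolumeForm Ω) :
    ∃ F : DiffForm (𝓘(ℝ, ℝ).prod (𝓡 (2 * m + 1))) (ℝ × S) ℝ (1 + m),
      IsGeneralisedPlaneWave g F ∧ ∀ x, F x ≠ 0 := by
  obtain ⟨Ω, hΩ⟩ := hΩ
  have hP := contMDiff_comp_snd hπ
  set P : ℝ × S → N := fun x => π x.2
  let q := sndPullback 𝒮.θ
  let α := pullField (𝓘(ℝ, ℝ).prod (𝓡 (2 * m + 1))) Ω P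
  have hq : IsSmoothForm q := IsSmoothForm.sndPullback 𝒮.smooth_θ
  have hα : IsSmoothForm α := isSmoothForm_pullField hΩ.holomorphic hP
  choose s hs using fun x => hg.exists_isTransverselyHermitian h𝒮 hπ x
  have hker : ∀ x v, fundamentalCoform (𝓡 (2 * m + 1)) g.g x ![v] = 0 ↔ q x ![v] = 0 :=
    fun x v => (hg.distribution x v).trans (by rw [sndPullback_apply])
  have hn : ∀ x, ∃ n, q x ![n] = 1 := by
    intro x
    have h : projDeriv x ((0, 𝒮.Z x.2) : ℝ × EuclideanSpace ℝ (Fin (2 * m + 1))) = 𝒮.Z x.2 := by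
      rw [projDeriv_eq]
      rfl
    exact ⟨_, (sndPullback_apply 𝒮.θ x _).trans ((congrArg (fun w => 𝒮.θ x.2 ![w]) h).trans
      (𝒮.θ_Z x.2))⟩
  choose n hn using hn
  choose f hf hqf using fun x => exists_smul_of_ker_eq (hker x) (hn x)
  -- the closedness is needed for all `c`, since the Hodge operator changes the phase of `α`
  have hclosed : ∀ (c : ℂ) x, extD (fun x => wedge (q x) (reForm c (α x))) x = 0 := by
    intro c x
    obtain ⟨k, hk⟩ := exists_complexLinear_antisymm (K.g (P x)) (K.symm _) (K.hermitian _)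
    refine extD_wedge_pullField_eq_zero hΩ.holomorphic hP hq c x k fun u v => ?_
    rw [extD_sndPullback 𝒮.smooth_θ, hπ.extD_contact_eq h𝒮, mfderiv_comp_snd hπ,
      mfderiv_comp_snd hπ]
    exact hk _ _
  have hsmooth : ∀ c : ℂ, IsSmoothForm fun x => wedge (q x) (reForm c (α x)) :=
    fun c => hq.wedge (hα.reForm c)
  -- `orientForm` does not vanish on orthonormal bases, and so it orients `ℝ × S`
  have hΦ : IsSmoothForm fun x =>
      orientForm (fundamentalCoform (𝓡 (2 * m + 1)) g.g x) (dtForm _ x) (α x) :=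
    ((g.smooth.fundamentalCoform.wedge (hα.reForm _)).wedge
      (isSmoothForm_dtForm.wedge (hα.reForm _))).sub
    ((g.smooth.fundamentalCoform.wedge (hα.reForm _)).wedge
      (isSmoothForm_dtForm.wedge (hα.reForm _)))
  obtain ⟨r, hr, hvol⟩ := g.exists_isVolumeForm (by omega) hΦ fun x e he h0 => by
    obtain ⟨d, ε, hd, hε, hval, -⟩ := (hs x).exists_sign he (hΩ.ne_zero (P x))
    have h1 : d * ε = 0 := hval.symm.trans h0
    rcases hε with rfl | rfl
    · linarith
    · linarith
  refine ⟨fun x => wedge (q x) (reForm 1 (α x)), ⟨⟨hsmooth 1, hclosed 1, _, hvol,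
    fun x => wedge (q x) (reForm (-Complex.I ^ m * 1) (α x)), hsmooth _, fun x => ?_, hclosed _⟩,
    q, fun x => reForm 1 (α x), hq, hα.reForm 1, fun x => ?_, fun x => rfl, fun x v hv hv' => ?_⟩,
    fun x => ?_⟩
  · have h := (hs x).isHodgeDual (hΩ.ne_zero (P x)) (hr x) rfl (hvol.unit x) (f x) 1
    rw [← hqf x] at h
    exact h
  · -- `q = f P♭` is dual to `f ∂/∂t`
    refine ⟨f x • fundamentalField x, ?_, ?_, fun v => ?_⟩
    · refine smul_ne_zero (hf x) fun h0 => ?_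
      have h1 := (hs x).T_p
      rw [h0] at h1
      have h2 := (oneFormLin (dtForm (𝓡 (2 * m + 1)) x)).map_zero
      exact zero_ne_one (h2.symm.trans h1)
    · have h1 := (hs x).dual (fundamentalField x)
      rw [(hs x).null] at h1
      rw [map_smul, map_smul, smul_apply, h1, smul_zero, smul_zero]
    · rw [map_smul, smul_apply, (hs x).dual, hqf x]
      rfl
  · apply inFormKernel_reForm_pullForm
    by_contra h0
    have h1 := (hs x).conformal v v ((hker x v).2 hv) ((hker x v).2 hv)
    have h2 := mul_pos (hs x).s_pos ((hs x).pos _ h0)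
    rw [← h1, hv'] at h2
    exact lt_irrefl _ h2
  · refine wedge_reForm_pullForm_ne_zero hm (hn x) (fun y => ?_) (hΩ.ne_zero (P x))
    obtain ⟨v, hv, hv'⟩ := (hs x).surj y
    exact ⟨v, (hker x v).1 hv, hv'⟩

end
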